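/- Let $K$ be a field and let $\Gamma=(\Gamma_0,\Gamma_1,\mu,\mathfrak o)$ be a Brauer configuration: $\Gamma_0$ is a finite set of vertices; $\Gamma_1$ is a finite collection of labelled finite multisets ("polygons") of elements of $\Gamma_0$, where $\operatorname{occ}(\alpha,V)$ is the multiplicity of $\alpha$ in $V$ and $\operatorname{val}(\alpha)=\sum_{V\in\Gamma_1}\operatorname{occ}(\alpha,V)$; $\mu\colon\Gamma_0\to\mathbb Z_{>0}$; and $\mathfrak o$ is a choice, for each vertex $\alpha$, of a cyclic ordering $V_1<V_2<\dots<V_{\operatorname{val}(\alpha)}<V_1$ of the list of polygons containing $\alpha$, in which each $V$ is listed $\operatorname{occ}(\alpha,V)$ times. It is required that every vertex lies in some polygon, that every polygon has at least two vertices (counted with repetition), and that every polygon has a vertex $\alpha$ with $\operatorname{val}(\alpha)\mu(\alpha)>1$. A vertex $\alpha$ is truncated if $\operatorname{val}(\alpha)\mu(\alpha)=1$. Let $\mathcal Q$ be the quiver with one vertex $v$ for each polygon $V$ and, for each nontruncated vertex $\alpha$ and each $i$, an arrow $a_i\colon v_i\to v_{i+1}$ given by $V_{i+1}$ being the successor of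 $V_i$ in the cyclic ordering at $\alpha$. The cycles $a_ia_{i+1}\cdots a_{\operatorname{val}(\alpha)}a_1\cdots a_{i-1}$ are the special $\alpha$-cycles at $v_i$. The Brauer configuration algebra $\Lambda=\Lambda_\Gamma$ is $K\mathcal Q/I$ (paths are composed from left to right), where the two-sided ideal $I$ is generated by: 1. all $C^{\mu(\alpha)}-C'^{\mu(\beta)}$, where $C$ is a special $\alpha$-cycle and $C'$ a special $\beta$-cycle at the same vertex $v$ of $\mathcal Q$; 2. all $C^{\mu(\alpha)}a$, where $C$ is a special $\alpha$-cycle with first arrow $a$; 3. all paths $ab$ of length two that are not subpaths of any special cycle, except when $a=b$ is a loop associated to a vertex $\alpha$ with $\operatorname{val}(\alpha)=1$ and $\mu(\alpha)>1$. Then: (1) $\Lambda$ is multiserial, that is, $\Lambda$ is finite dimensional over $K$ and, for every indecomposable projective left or right $\Lambda$-module $P$, $\operatorname{rad}(P)$ is a sum $\sum_{i=1}^n U_i$ of finitely many uniserial submodules such that $U_i\cap U_j$ is zero or simple for all $i\neq j$. (2) Every indecomposable projective right $\Lambda$-module $P$ is isomorphic to $e_v\Lambda$ for exactly one polygon $V$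 (where $e_v\in\Lambda$ is the class of the trivial path at $v$), called the polygon corresponding to $P$. If $\operatorname{rad}^2(P)\neq 0$, then the number of summands in the heart $\operatorname{rad}(P)/\operatorname{soc}(P)$ of $P$ equals the number $r$ of nontruncated vertices of $V$, counted with repetition: the heart is a direct sum of $r$ nonzero uniserial submodules, and every decomposition of the heart into a finite direct sum of indecomposable submodules has exactly $r$ summands. -/

import Mathlib

universe u v w z

noncomputable section

/-! ### Path algebras of quivers -/

/-- The set of all (finite, directed) paths of a quiver, with their end points. -/
abbrev QPath (Q : Type u) [Quiver.{v} Q] : Type (max u v) := Σ a b : Q, Quiver.Path a b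

/-- The path algebra `KQ`: the vector space with basis the set of all paths of `Q`. -/
def PathAlgebra (K : Type w) (Q : Type u) [Quiver.{v} Q] [Field K] : Type (max u v w) :=
  QPath Q →₀ K

namespace PathAlgebra

variable (K : Type w) (Q : Type u) [Quiver.{v} Q] [Field K]

instance : AddCommGroup (PathAlgebra K Q) := inferInstanceAs (AddCommGroup (QPath Q →₀ K))
instance : Module K (PathAlgebra K Q) := inferInstanceAs (Module K (QPath Q →₀ K))

variable {Q}

/-- The basis element of `KQ` given by a path. -/
def ofPath {a b : Q} (p : Quiver.Path a b) : PathAlgebra K Q :=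
  Finsupp.single (⟨a, b, p⟩ : QPath Q) (1 : K)

open Classical in
/-- The product of two paths `p`, `q` : the concatenation "first `p`, then `q`" if `p` ends where
`q` begins, and zero otherwise. -/
def pathMul (p q : QPath Q) : PathAlgebra K Q :=
  if h : p.2.1 = q.1 then ofPath K (p.2.2.comp (q.2.2.cast h.symm rfl)) else 0

/-- The bilinear extension of `pathMul`. -/
def mulHom : PathAlgebra K Q →ₗ[K] PathAlgebra K Q →ₗ[K] PathAlgebra K Q :=
  Finsupp.lift (PathAlgebra K Q →ₗ[K] PathAlgebra K Q) K (QPath Q) fun p =>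
    Finsupp.lift (PathAlgebra K Q) K (QPath Q) fun q => pathMul K p q

instance : Mul (PathAlgebra K Q) := ⟨fun x y => mulHom K x y⟩

/-- The identity of `KQ`: the sum of the trivial paths at all vertices. -/
instance [Fintype Q] : One (PathAlgebra K Q) :=
  ⟨∑ a : Q, ofPath K (Quiver.Path.nil : Quiver.Path a a)⟩

variable {K}

theorem mul_def (x y : PathAlgebra K Q) : x * y = mulHom K x y := rfl

theorem one_def [Fintype Q] :
    (1 : PathAlgebra K Q) = ∑ a : Q, ofPath K (Quiver.Path.nil : Quiver.Path a a) := rfl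

theorem ofPath_mul_ofPath {a b c d : Q} (p : Quiver.Path a b) (q : Quiver.Path c d) :
    ofPath K p * ofPath K q = pathMul K ⟨a, b, p⟩ ⟨c, d, q⟩ := by
  have key : ∀ (N : Type (max u v w)) [AddCommGroup N] [Module K N] (f : QPath Q → N) (x : QPath Q),
      Finsupp.lift N K (QPath Q) f (Finsupp.single x 1) = f x := fun N _ _ f x => by simp
  have h : mulHom K (ofPath K p) = Finsupp.lift (PathAlgebra K Q) K (QPath Q)
      fun q => pathMul K ⟨a, b, p⟩ q := key _ _ _
  rw [mul_def, h]
  exact key _ _ _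

theorem ofPath_mul_ofPath_of_eq {a b c : Q} (p : Quiver.Path a b) (q : Quiver.Path b c) :
    ofPath K p * ofPath K q = ofPath K (p.comp q) := by
  rw [ofPath_mul_ofPath]
  simp [pathMul]

theorem ofPath_mul_ofPath_of_ne {a b c d : Q} (p : Quiver.Path a b) (q : Quiver.Path c d)
    (h : b ≠ c) : ofPath K p * ofPath K q = 0 := by
  rw [ofPath_mul_ofPath]
  simp [pathMul, h]

/-- Every element is a linear combination of paths. -/
theorem induction_path {C : PathAlgebra K Q → Prop} (h0 : C 0)
    (hadd : ∀ x y, C x → C y → C (x + y))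
    (hsm : ∀ (k : K) {a b : Q} (p : Quiver.Path a b), C (k • ofPath K p)) (x) : C x := by
  refine Finsupp.induction_linear (motive := C) x h0 hadd ?_
  rintro ⟨a, b, p⟩ k
  have := hsm k p
  have e : k • ofPath K p = (Finsupp.single (⟨a, b, p⟩ : QPath Q) k : QPath Q →₀ K) := by
    change k • (Finsupp.single (⟨a, b, p⟩ : QPath Q) (1 : K) : QPath Q →₀ K) = _
    simp
  rwa [e] at this

theorem add_mul_aux (x y z : PathAlgebra K Q) : (x + y) * z = x * z + y * z := by
  simp [mul_def]

theorem mul_add_aux (x y z : PathAlgebra K Q) : x * (y + z) = x * y + x * z := by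
  simp [mul_def]

theorem zero_mul_aux (x : PathAlgebra K Q) : 0 * x = 0 := by simp [mul_def]

theorem mul_zero_aux (x : PathAlgebra K Q) : x * 0 = 0 := by simp [mul_def]

theorem smul_mul_aux (k : K) (x y : PathAlgebra K Q) : (k • x) * y = k • (x * y) := by
  simp [mul_def]

theorem mul_smul_aux (k : K) (x y : PathAlgebra K Q) : x * (k • y) = k • (x * y) := by
  simp [mul_def]

theorem mul_assoc_aux (x y z : PathAlgebra K Q) : x * y * z = x * (y * z) := by
  induction x using induction_path with
  | h0 => simp only [zero_mul_aux]
  | hadd x x' h h' => simp only [add_mul_aux, h, h']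
  | hsm k p =>
    induction y using induction_path with
    | h0 => simp only [zero_mul_aux, mul_zero_aux]
    | hadd x x' h h' => simp only [add_mul_aux, mul_add_aux, h, h']
    | hsm l q =>
      induction z using induction_path with
      | h0 => simp only [mul_zero_aux]
      | hadd x x' h h' => simp only [mul_add_aux, h, h']
      | hsm m r =>
        simp only [smul_mul_aux, mul_smul_aux]
        congr 3
        rename_i a b c d e f
        by_cases h1 : b = c
        · subst h1
          rw [ofPath_mul_ofPath_of_eq]
          by_cases h2 : d = e
          · subst h2
            simp only [ofPath_mul_ofPath_of_eq, Quiver.Path.comp_assoc]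
          · rw [ofPath_mul_ofPath_of_ne _ _ h2, ofPath_mul_ofPath_of_ne _ _ h2, mul_zero_aux]
        · rw [ofPath_mul_ofPath_of_ne _ _ h1, zero_mul_aux]
          by_cases h2 : d = e
          · subst h2
            rw [ofPath_mul_ofPath_of_eq, ofPath_mul_ofPath_of_ne _ _ h1]
          · rw [ofPath_mul_ofPath_of_ne _ _ h2, mul_zero_aux]

theorem sum_mul_aux {ι : Type*} (s : Finset ι) (f : ι → PathAlgebra K Q)
    (x : PathAlgebra K Q) : (∑ i ∈ s, f i) * x = ∑ i ∈ s, f i * x := by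
  simp [mul_def]

theorem mul_sum_aux {ι : Type*} (s : Finset ι) (f : ι → PathAlgebra K Q)
    (x : PathAlgebra K Q) : x * (∑ i ∈ s, f i) = ∑ i ∈ s, x * f i := by
  simp [mul_def]

theorem one_mul_aux [Fintype Q] (x : PathAlgebra K Q) : 1 * x = x := by
  induction x using induction_path with
  | h0 => exact mul_zero_aux _
  | hadd x y h h' => rw [mul_add_aux, h, h']
  | hsm k p =>
    rename_i a b
    rw [mul_smul_aux, one_def, sum_mul_aux, Finset.sum_eq_single a]
    · rw [ofPath_mul_ofPath_of_eq, Quiver.Path.nil_comp]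
    · intro c _ hc
      exact ofPath_mul_ofPath_of_ne _ _ hc
    · simp

theorem mul_one_aux [Fintype Q] (x : PathAlgebra K Q) : x * 1 = x := by
  induction x using induction_path with
  | h0 => exact zero_mul_aux _
  | hadd x y h h' => rw [add_mul_aux, h, h']
  | hsm k p =>
    rename_i a b
    rw [smul_mul_aux, one_def, mul_sum_aux, Finset.sum_eq_single b]
    · rw [ofPath_mul_ofPath_of_eq, Quiver.Path.comp_nil]
    · intro c _ hc
      exact ofPath_mul_ofPath_of_ne _ _ hc.symm
    · simp

instance [Fintype Q] : Ring (PathAlgebra K Q) :=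
  { (inferInstance : AddCommGroup (PathAlgebra K Q)),
    (inferInstance : Mul (PathAlgebra K Q)),
    (inferInstance : One (PathAlgebra K Q)) with
    left_distrib := mul_add_aux
    right_distrib := add_mul_aux
    zero_mul := zero_mul_aux
    mul_zero := mul_zero_aux
    mul_assoc := mul_assoc_aux
    one_mul := one_mul_aux
    mul_one := mul_one_aux }

instance [Fintype Q] : Algebra K (PathAlgebra K Q) :=
  Algebra.ofModule smul_mul_aux mul_smul_aux

end PathAlgebra

/-! ### Brauer configurations -/

/-- A Brauer configuration with vertex set `Γ₀` and (labelled) polygons `Γ₁`. Each polygon is a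
finite multiset of vertices. With `Γ₁` finite, finiteness of `Γ₀` follows from `exists_polygon`.
An orientation is a cyclic ordering, at each vertex `α`, of the list of polygons at `α` in which
every polygon `V` is listed `occ(α, V)` times. The entries of this list are the pairs `⟨V, i⟩` with
`i < occ(α, V)`, and a cyclic ordering of them is a permutation (sending each entry to its
successor) that has a single cycle. -/
structure BrauerConfiguration (Γ₀ : Type u) (Γ₁ : Type v) [DecidableEq Γ₀] [Fintype Γ₁] where
  /-- the multiset of vertices of a polygon -/
  polygon : Γ₁ → Multiset Γ₀
  /-- the multiplicity function, with values in the positive integers -/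
  mult : Γ₀ → ℕ
  mult_pos : ∀ α, 0 < mult α
  /-- the orientation: the successor of each entry of the list at `α` -/
  succ : ∀ α : Γ₀, Equiv.Perm (Σ V : Γ₁, Fin ((polygon V).count α))
  succ_isCycle : ∀ α : Γ₀, (succ α).IsCycleOn Set.univ
  exists_polygon : ∀ α : Γ₀, ∃ V : Γ₁, α ∈ polygon V
  two_le_card : ∀ V : Γ₁, 2 ≤ (polygon V).card
  exists_vertex : ∀ V : Γ₁, ∃ α ∈ polygon V, 1 < (∑ W : Γ₁, (polygon W).count α) * mult α

namespace BrauerConfiguration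

variable {Γ₀ : Type u} {Γ₁ : Type v} [DecidableEq Γ₀] [Fintype Γ₁]
  (Γ : BrauerConfiguration Γ₀ Γ₁)

/-- `occ(α, V)`: how often the vertex `α` occurs in the polygon `V`. -/
def occ (α : Γ₀) (V : Γ₁) : ℕ := (Γ.polygon V).count α

/-- The valence of a vertex. -/
def val (α : Γ₀) : ℕ := ∑ V : Γ₁, Γ.occ α V

/-- A vertex `α` is truncated if `val(α) μ(α) = 1`. -/
def IsTruncated (α : Γ₀) : Prop := Γ.val α * Γ.mult α = 1

instance : DecidablePred Γ.IsTruncated := fun α => Nat.decEq (Γ.val α * Γ.mult α) 1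

/-- The number of nontruncated vertices of the polygon `V`, counting repetitions. -/
def numNontruncated (V : Γ₁) : ℕ := (Γ.polygon V).countP fun α => ¬ Γ.IsTruncated α

/-- An entry of the successor sequence at some nontruncated vertex. -/
structure Entry where
  /-- the nontruncated vertex at which the successor sequence is taken -/
  vertex : Γ₀
  nontruncated : ¬ Γ.IsTruncated vertex
  /-- the entry of the list of polygons at `vertex` -/
  entry : Σ V : Γ₁, Fin ((Γ.polygon V).count vertex)

variable {Γ}

/-- The polygon listed at an entry. -/
def Entry.poly (o : Γ.Entry) : Γ₁ := o.entry.1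

/-- The next entry of the same successor sequence. -/
def Entry.next (o : Γ.Entry) : Γ.Entry := ⟨o.vertex, o.nontruncated, Γ.succ o.vertex o.entry⟩

/-- The entry reached after `n` steps. -/
def Entry.iter (o : Γ.Entry) : ℕ → Γ.Entry
  | 0 => o
  | n + 1 => (o.iter n).next

variable (Γ)

/-- The vertices of the quiver of `Γ`: one for each polygon. -/
def QVertex (_ : BrauerConfiguration Γ₀ Γ₁) : Type v := Γ₁

instance : Fintype Γ.QVertex := inferInstanceAs (Fintype Γ₁)

/-- The quiver of `Γ`: the arrows from `V` to `W` are the occurrences of `W` as the successor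
of `V` in the successor sequences at nontruncated vertices. -/
instance : Quiver Γ.QVertex where
  Hom V W := {o : Γ.Entry // o.poly = V ∧ o.next.poly = W}

variable {Γ}

/-- The vertex of the quiver associated to the polygon listed at an entry. -/
def Entry.vtx (o : Γ.Entry) : Γ.QVertex := o.poly

/-- The arrow given by an entry and its successor. -/
def Entry.arrow (o : Γ.Entry) : o.vtx ⟶ o.next.vtx := ⟨o, rfl, rfl⟩

/-- The path of length `n` that starts at an entry and runs through the successor sequence. -/
def Entry.path (o : Γ.Entry) : (n : ℕ) → Quiver.Path o.vtx (o.iter n).vtx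
  | 0 => Quiver.Path.nil
  | n + 1 => (o.path n).cons (o.iter n).arrow

/-- The special `α`-cycle `C = a₁ ⋯ a_{val(α)}` starting at an entry of the successor sequence
at `α`. (The entry reached after `val(α)` steps is the initial one.) -/
def Entry.cycle (o : Γ.Entry) : Quiver.Path o.vtx (o.iter (Γ.val o.vertex)).vtx :=
  o.path (Γ.val o.vertex)

variable (Γ) (K : Type w) [Field K]

/-- The element `C^{μ(α)}` of the path algebra, for the special `α`-cycle `C` at an entry. -/
def Entry.cyclePow {Γ : BrauerConfiguration Γ₀ Γ₁} (o : Γ.Entry) : PathAlgebra K Γ.QVertex :=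
  PathAlgebra.ofPath K o.cycle ^ Γ.mult o.vertex

/-- Relations of type one: `C^{μ(α)} - C'^{μ(β)}` for special cycles `C`, `C'` (at nontruncated
vertices `α`, `β`) that start at the same vertex of the quiver. -/
def relOne : Set (PathAlgebra K Γ.QVertex) :=
  {x | ∃ o o' : Γ.Entry, o.poly = o'.poly ∧ x = o.cyclePow K - o'.cyclePow K}

/-- Relations of type two: `C^{μ(α)} a` for special cycles `C` with first arrow `a`. -/
def relTwo : Set (PathAlgebra K Γ.QVertex) :=
  {x | ∃ o : Γ.Entry, x = o.cyclePow K * PathAlgebra.ofPath K o.arrow.toPath}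

/-- The path `p` is a subpath of some special cycle. -/
def InSpecialCycle {a b : Γ.QVertex} (p : Quiver.Path a b) : Prop :=
  ∃ (o : Γ.Entry) (l : Quiver.Path o.vtx a)
    (r : Quiver.Path b (o.iter (Γ.val o.vertex)).vtx), o.cycle = (l.comp p).comp r

/-- Relations of type three: the paths `ab` of length two that are not subpaths of any special
cycle, unless `a = b` is a loop associated to a vertex `α` with `val(α) = 1` and `μ(α) > 1`. -/
def relThree : Set (PathAlgebra K Γ.QVertex) :=
  {x | ∃ (V W X : Γ.QVertex) (a : V ⟶ W) (b : W ⟶ X),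
    ¬ Γ.InSpecialCycle (a.toPath.cons b) ∧
    ¬ (a.1 = b.1 ∧ Γ.val a.1.vertex = 1 ∧ 1 < Γ.mult a.1.vertex) ∧
    x = PathAlgebra.ofPath K (a.toPath.cons b)}

/-- The two-sided ideal generated by the relations. -/
def relIdeal : TwoSidedIdeal (PathAlgebra K Γ.QVertex) :=
  TwoSidedIdeal.span (Γ.relOne K ∪ Γ.relTwo K ∪ Γ.relThree K)

/-- The Brauer configuration algebra of `Γ` over `K`. -/
abbrev BCAlgebra : Type (max u v w) := (Γ.relIdeal K).ringCon.Quotient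

/-- The idempotent of the algebra given by the trivial path at the polygon `V`. -/
def idem (V : Γ₁) : Γ.BCAlgebra K :=
  (Γ.relIdeal K).ringCon.mk' (PathAlgebra.ofPath K (@Quiver.Path.nil Γ.QVertex _ V))

/-- The projective right module `e_V Λ` associated to the polygon `V` (right modules over a ring
are modules over the opposite ring). -/
def proj (V : Γ₁) : Submodule (Γ.BCAlgebra K)ᵐᵒᵖ (Γ.BCAlgebra K) :=
  Submodule.span (Γ.BCAlgebra K)ᵐᵒᵖ {Γ.idem K V}

end BrauerConfiguration

/-! ### Modules -/

section Modules

variable (A : Type u) [Ring A] (M : Type v) [AddCommGroup M] [Module A M]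

/-- Nonzero, and not the direct sum of two nonzero submodules. -/
def IsIndecomposableModule : Prop :=
  Nontrivial M ∧ ∀ N N' : Submodule A M, IsCompl N N' → N = ⊥ ∨ N' = ⊥

/-- The submodules form a chain. -/
def IsUniserialModule : Prop :=
  ∀ N N' : Submodule A M, N ≤ N' ∨ N' ≤ N

/-- The socle: the sum of all simple submodules. -/
def moduleSocle : Submodule A M := sSup {N : Submodule A M | IsSimpleModule A N}

/-- The heart `rad(M) / soc(M)` (more precisely `rad(M) / (rad(M) ∩ soc(M))`). -/
abbrev ModuleHeart : Type v :=
  ↥(Module.jacobson A M) ⧸ (moduleSocle A M).submoduleOf (Module.jacobson A M)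

/-- `rad(M)` is a finite sum of uniserial submodules, any two of which intersect in zero or in a
simple module. -/
def HasMultiserialRadical : Prop :=
  ∃ (n : ℕ) (U : Fin n → Submodule A M),
    (∀ i, IsUniserialModule A (U i)) ∧ Module.jacobson A M = ⨆ i, U i ∧
    ∀ i j, i ≠ j → U i ⊓ U j = ⊥ ∨ IsSimpleModule A ↥(U i ⊓ U j)

end Modules

/-- A multiserial algebra: a finite dimensional algebra such that the radical of every
indecomposable projective left or right module is a sum of uniserial submodules whose pairwise
intersections are zero or simple. -/
def IsMultiserialAlgebra (K : Type u) (A : Type v) [Field K] [Ring A] [Algebra K A] : Prop :=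
  FiniteDimensional K A ∧
  (∀ (P : Type w) [AddCommGroup P] [Module A P], Module.Projective A P →
    IsIndecomposableModule A P → HasMultiserialRadical A P) ∧
  (∀ (P : Type w) [AddCommGroup P] [Module Aᵐᵒᵖ P], Module.Projective Aᵐᵒᵖ P →
    IsIndecomposableModule Aᵐᵒᵖ P → HasMultiserialRadical Aᵐᵒᵖ P)

end

-- By the relations of type three, a product of arrows survives in `Λ` only if each arrow is the
-- successor of the one before it. So `Λ` is spanned by the idempotents and by paths that are
-- determined by a first arrow `o` and a length `n`. Relations of type two kill such a path beyond
-- length `len o = val(α) μ(α)`, and relations of type one identify the maximal paths starting at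
-- the same vertex. What remains to be excluded is a further collapse. For this, no basis of `Λ` is
-- constructed: a linear form with value 1 at the maximal paths and 0 at all others vanishes on the
-- ideal (`relIdeal_le_formIdeal`). The coefficient of a nonmaximal path in an element `b` is then
-- the form evaluated at the product of `b` with the path completing it to a maximal one (`coef`),
-- and an element of the radical all of whose nonmaximal coefficients vanish is a combination of
-- maximal paths (`mem_top_of_coef_eq_zero`).
--
-- `CyclicPathData` records exactly this information for left modules. `Λ` yields one instance by
-- following successors backwards and `Λᵐᵒᵖ` another by following them forwards, so both sides are
-- treated at once.
--
-- An indecomposable projective is generated by an element `m` with the annihilator of some `e v`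
-- (`exists_isVertexGenerator`). Its radical is the sum of the submodules generated by the arrows at
-- `v`. Each of these is uniserial, because a path can be prolonged by only one arrow. Comparing
-- coefficients shows that two of them meet inside the socle, which is simple and generated by the
-- maximal path, and that modulo the socle their sum is direct. Since `len` is at least 2, no arrow
-- lies in the socle, so the heart has one nonzero uniserial summand for each entry of `V` at a
-- nontruncated vertex.
--
-- That the number of summands does not depend on the decomposition is a case of Krull–Schmidt
-- (`card_eq_of_isInternal_of_isUniserialModule`): indecomposable summands of a direct sum of
-- uniserial modules are uniserial, and the number of uniserial summands is the length of the module
-- modulo its radical.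

universe t y

noncomputable section

/-! ### Uniserial modules and Fitting's lemma -/

section UniserialModules

variable {A : Type u} [Ring A] {M : Type v} [AddCommGroup M] [Module A M]
  {M' : Type w} [AddCommGroup M'] [Module A M']

theorem IsUniserialModule.of_injective (h : IsUniserialModule A M') (f : M →ₗ[A] M')
    (hf : Function.Injective f) : IsUniserialModule A M := fun N N' => by
  have key := h (N.map f) (N'.map f)
  rwa [Submodule.map_le_map_iff_of_injective hf, Submodule.map_le_map_iff_of_injective hf] at key

theorem IsUniserialModule.of_surjective (h : IsUniserialModule A M) (f : M →ₗ[A] M')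
    (hf : Function.Surjective f) : IsUniserialModule A M' := fun N N' => by
  have key := h (N.comap f) (N'.comap f)
  rwa [Submodule.comap_le_comap_iff_of_surjective hf,
    Submodule.comap_le_comap_iff_of_surjective hf] at key

/-- A submodule is uniserial if it starts a finite descending chain of submodules, each of which
contains every proper submodule of its predecessor. -/
theorem isUniserialModule_of_chain (W : ℕ → Submodule A M) (l : ℕ) (hl : W l = ⊥)
    (hW : ∀ k N, N ≤ W k → N = W k ∨ N ≤ W (k + 1)) (anti : Antitone W) :
    IsUniserialModule A (W 0) := by
  -- A submodule that differs from every `W k` would descend through the whole chain and so equal `W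
  -- l = ⊥` after all.
  have key : ∀ N : Submodule A M, N ≤ W 0 → ∃ k, N = W k := by
    intro N hN0
    by_contra! hN
    have : ∀ k, N ≤ W k := by
      intro k
      induction k with
      | zero => exact hN0
      | succ k ih => exact (hW k N ih).resolve_left (hN k)
    exact hN l (le_antisymm (this l) (by simp [hl]))
  intro N N'
  obtain ⟨k, hk⟩ := key _ (Submodule.map_subtype_le (W 0) N)
  obtain ⟨k', hk'⟩ := key _ (Submodule.map_subtype_le (W 0) N')
  have h := (le_total k' k).imp (fun h => anti h) fun h => anti h
  rwa [← hk, ← hk', Submodule.map_le_map_iff_of_injective (W 0).injective_subtype,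
    Submodule.map_le_map_iff_of_injective (W 0).injective_subtype] at h

/-- Two maximal submodules in a chain are comparable, hence equal; the noetherian hypothesis
provides one. -/
theorem isCoatom_jacobson_of_isUniserialModule [IsNoetherian A M] [Nontrivial M]
    (h : IsUniserialModule A M) : IsCoatom (Module.jacobson A M) := by
  obtain ⟨N, hN, -⟩ := (eq_top_or_exists_le_coatom (⊥ : Submodule A M)).resolve_left bot_ne_top
  have : Module.jacobson A M = N := by
    refine le_antisymm (sInf_le hN) (le_sInf fun N' hN' => ?_)
    rcases h N N' with h | h
    · exact h
    · rcases hN'.le_iff.1 h with h' | h'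
      · exact absurd h' hN.1
      · exact h'.le
  rwa [this]

/-- Fitting's lemma: the kernel and the range of a high power of `f` are complementary, so one of
them vanishes, and either `f` is bijective or `f` is nilpotent and `1 - f` is a unit. -/
theorem isLocalRing_end_of_isIndecomposableModule [IsNoetherian A M] [IsArtinian A M]
    (h : IsIndecomposableModule A M) : IsLocalRing (Module.End A M) := by
  have := h.1
  refine IsLocalRing.of_isUnit_or_isUnit_one_sub_self fun f => ?_
  obtain ⟨n, hn⟩ := Filter.eventually_atTop.1 (LinearMap.eventually_isCompl_ker_pow_range_pow f)
  have hn := hn (n + 1) (Nat.le_succ n)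
  rcases h.2 _ _ hn with h' | h'
  · left
    have hinj : Function.Injective (f ^ (n + 1)) := LinearMap.ker_eq_bot.1 h'
    have hf : Function.Injective f := by
      rw [pow_succ] at hinj
      exact Function.Injective.of_comp hinj
    exact (Module.End.isUnit_iff f).2 (IsArtinian.bijective_of_injective_endomorphism f hf)
  · right
    exact IsNilpotent.isUnit_one_sub ⟨n + 1, LinearMap.range_eq_bot.1 h'⟩

end UniserialModules

/-! ### Counting the summands of a direct sum of uniserial modules -/

section InternalDirectSums

variable {A : Type u} [Ring A] {M : Type v} [AddCommGroup M] [Module A M]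
  {ι : Type w} [Fintype ι] [DecidableEq ι]

/-- The isomorphism from the product of the summands of a finite direct decomposition. -/
def DirectSum.IsInternal.piEquiv {N : ι → Submodule A M} (h : DirectSum.IsInternal N) :
    (Π i, N i) ≃ₗ[A] M :=
  (DirectSum.linearEquivFunOnFintype A ι fun i => N i).symm.trans
    (LinearEquiv.ofBijective (DirectSum.coeLinearMap N) h)

theorem DirectSum.IsInternal.piEquiv_apply {N : ι → Submodule A M} (h : DirectSum.IsInternal N)
    (x : Π i, N i) : h.piEquiv x = ∑ i, (x i : M) := by
  obtain ⟨y, rfl⟩ := (DirectSum.linearEquivFunOnFintype A ι fun i => N i).surjective x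
  have : h.piEquiv (DirectSum.linearEquivFunOnFintype A ι (fun i => N i) y) =
      DirectSum.coeLinearMap N y := by
    simp only [DirectSum.IsInternal.piEquiv, LinearEquiv.trans_apply,
      LinearEquiv.symm_apply_apply]
    rfl
  classical
  rw [this, DirectSum.coeLinearMap_eq_dfinsuppSum, DFinsupp.sum_eq_sum_fintype]
  · simp
  · simp

theorem jacobson_pi_eq (N : ι → Type v) [∀ i, AddCommGroup (N i)] [∀ i, Module A (N i)] :
    Module.jacobson A (Π i, N i) = Submodule.pi Set.univ fun i => Module.jacobson A (N i) := by
  refine le_antisymm (Module.jacobson_pi_le A N) fun x hx => ?_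
  have : x = ∑ i, LinearMap.single A N i (x i) := by
    ext j; simp
  rw [this]
  refine Submodule.sum_mem _ fun i _ => ?_
  exact Module.map_jacobson_le _ (Submodule.mem_map_of_mem (hx i trivial))

/-- The quotient of a product by a product of submodules is the product of the quotients. -/
def quotientPiEquiv {N : ι → Type v} [∀ i, AddCommGroup (N i)] [∀ i, Module A (N i)]
    (p : ∀ i, Submodule A (N i)) :
    ((Π i, N i) ⧸ Submodule.pi Set.univ p) ≃ₗ[A] Π i, (N i ⧸ p i) :=
  let f : (Π i, N i) →ₗ[A] Π i, (N i ⧸ p i) :=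
    LinearMap.pi fun i => (p i).mkQ ∘ₗ LinearMap.proj i
  (Submodule.quotEquivOfEq _ _ (by
    ext x
    simp [f, funext_iff, Submodule.mem_pi])).trans
    (f.quotKerEquivOfSurjective fun y => by
      choose x hx using fun i => (p i).mkQ_surjective (y i)
      exact ⟨x, funext hx⟩)

/-- Each uniserial summand has a simple top, and the radical of a finite product is the product of
the radicals. This makes the number of summands an invariant of `M`. -/
theorem length_quotient_jacobson_of_isInternal [IsNoetherian A M] {N : ι → Submodule A M}
    (h : DirectSum.IsInternal N) (hN : ∀ i, Nontrivial (N i))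
    (hU : ∀ i, IsUniserialModule A (N i)) :
    Module.length A (M ⧸ Module.jacobson A M) = Fintype.card ι := by
  have h1 : Submodule.map (h.piEquiv : (Π i, N i) →ₗ[A] M) (Module.jacobson A (Π i, N i)) =
      Module.jacobson A M := Module.map_jacobson_of_bijective h.piEquiv.bijective
  rw [← (Submodule.Quotient.equiv _ _ h.piEquiv h1).length_eq, jacobson_pi_eq,
    (quotientPiEquiv fun i => Module.jacobson A (N i)).length_eq,
    Module.length_pi_of_fintype]
  have : ∀ i, Module.length A (N i ⧸ Module.jacobson A (N i)) = 1 := fun i => by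
    rw [Module.length_eq_one_iff, isSimpleModule_iff_isCoatom]
    exact isCoatom_jacobson_of_isUniserialModule (hU i)
  simp [this]

/-- The identity of `N` is the sum of the endomorphisms that factor through the `W i`. As `End N` is
local, one of these is a unit, and `N` embeds in that `W i`. -/
theorem isUniserialModule_of_isIndecomposableModule_of_isCompl [IsNoetherian A M] [IsArtinian A M]
    {W : ι → Submodule A M} (h : DirectSum.IsInternal W) (hU : ∀ i, IsUniserialModule A (W i))
    {N N' : Submodule A M} (hN : IsIndecomposableModule A N) (hc : IsCompl N N') :
    IsUniserialModule A N := by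
  have := isLocalRing_end_of_isIndecomposableModule hN
  let q : M →ₗ[A] N := N.projectionOnto N' hc
  let p : ∀ i, M →ₗ[A] W i := fun i =>
    (LinearMap.proj (φ := fun i => W i) i).comp (h.piEquiv.symm : M →ₗ[A] _)
  let f : ι → Module.End A N := fun i => q ∘ₗ (W i).subtype ∘ₗ p i ∘ₗ N.subtype
  have hf : IsUnit (∑ i, f i) := by
    have : ∑ i, f i = 1 := by
      ext x
      have h1 : ∑ i, ((p i x : W i) : M) = x := by
        have := h.piEquiv_apply (h.piEquiv.symm (x : M))
        rw [LinearEquiv.apply_symm_apply] at this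
        exact this.symm
      have h2 : (∑ i, f i) x = q (∑ i, ((p i x : W i) : M)) := by
        simp [f, LinearMap.sum_apply]
      rw [h2, h1]
      simp [q]
    rw [this]
    exact isUnit_one
  obtain ⟨i, -, hi⟩ := IsLocalRing.exists_of_isUnit_sum hf
  have hinj : Function.Injective (f i) := ((Module.End.isUnit_iff _).1 hi).1
  refine (hU i).of_injective (p i ∘ₗ N.subtype) ?_
  intro x y hxy
  apply hinj
  simp only [LinearMap.comp_apply] at hxy
  simp only [f, LinearMap.comp_apply, hxy]

/-- Any decomposition of a finite direct sum of nonzero uniserial modules of finite length into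
indecomposable modules has the same number of summands. -/
theorem card_eq_of_isInternal_of_isUniserialModule [IsNoetherian A M] [IsArtinian A M]
    {W : ι → Submodule A M} (h : DirectSum.IsInternal W) (hW : ∀ i, Nontrivial (W i))
    (hU : ∀ i, IsUniserialModule A (W i)) {κ : Type z} [Fintype κ] [DecidableEq κ]
    {N : κ → Submodule A M} (h' : DirectSum.IsInternal N)
    (hN : ∀ i, IsIndecomposableModule A (N i)) : Fintype.card κ = Fintype.card ι := by
  have hN' : ∀ i, IsUniserialModule A (N i) := fun i => by
    obtain ⟨h1, h2⟩ := (DirectSum.isInternal_submodule_iff_iSupIndep_and_iSup_eq_top N).1 h'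
    refine isUniserialModule_of_isIndecomposableModule_of_isCompl (N' := ⨆ (j) (_ : j ≠ i), N j)
      h hU (hN i) ⟨h1 i, codisjoint_iff.2 ?_⟩
    rw [← h2]
    exact (iSup_split_single N i).symm
  have e1 := length_quotient_jacobson_of_isInternal h hW hU
  have e2 := length_quotient_jacobson_of_isInternal h' (fun i => (hN i).1) hN'
  exact_mod_cast e2.symm.trans e1

end InternalDirectSums

section Transfer

variable {A : Type u} [Ring A] {M : Type v} [AddCommGroup M] [Module A M]

theorem jacobson_eq_of_isCoatom {R : Submodule A M} (hR : IsCoatom R)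
    (h : ∀ N : Submodule A M, N ≤ R ∨ N = ⊤) : Module.jacobson A M = R := by
  refine le_antisymm (sInf_le hR) (le_sInf fun N hN => ?_)
  exact (hN.le_iff.1 ((h N).resolve_right hN.1)).elim (fun h => absurd h hR.1) fun h => h.le

end Transfer

/-! ### Algebras spanned by cyclic paths -/

/-- An algebra spanned by orthogonal idempotents `e v` and by paths `x o n`, where `x o n` is the
path of length `n` that starts with the arrow `o` and follows the permutation `next` of the arrows.
Products are written such that `y * x` means "first `x`, then `y`". The paths `x o (len o)` only
depend on the vertex at which they start, longer paths vanish, and the functional `form` takes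
the value `1` at them and vanishes at all other paths. -/
structure CyclicPathData (K : Type w) (A : Type u) [Field K] [Ring A] [Algebra K A]
    (V : Type v) [Fintype V] (O : Type z) where
  /-- the idempotents -/
  e : V → A
  /-- the paths -/
  x : O → ℕ → A
  /-- the vertex at which an arrow starts -/
  vtx : O → V
  /-- the arrow that follows an arrow -/
  next : Equiv.Perm O
  /-- the length of the longest path that starts with an arrow -/
  len : O → ℕ
  two_le_len : ∀ o, 2 ≤ len o
  len_next : ∀ o, len (next o) = len o
  vtx_surjective : Function.Surjective vtx
  e_mul_self : ∀ v, e v * e v = e v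
  e_mul_ne : ∀ v v', v ≠ v' → e v * e v' = 0
  sum_e : ∑ v, e v = 1
  x_zero : ∀ o, x o 0 = e (vtx o)
  x_succ : ∀ o n, x o (n + 1) = x ((next ^ n) o) 1 * x o n
  e_mul_x_one : ∀ o, e (vtx (next o)) * x o 1 = x o 1
  x_one_mul_x_one : ∀ o o', o' ≠ next o → x o' 1 * x o 1 = 0
  x_len_eq : ∀ o o', vtx o = vtx o' → x o (len o) = x o' (len o')
  x_len_succ : ∀ o, x o (len o + 1) = 0
  span_eq_top : Submodule.span K (Set.range e ∪ {y | ∃ o n, y = x o n}) = ⊤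
  /-- the linear functional -/
  form : A →ₗ[K] K
  form_x : ∀ o n, form (x o n) = if n = len o then 1 else 0

namespace CyclicPathData

variable {K : Type w} {A : Type u} [Field K] [Ring A] [Algebra K A]
    {V : Type v} [Fintype V] {O : Type z} (D : CyclicPathData K A V O)

theorem len_pow (n : ℕ) (o : O) : D.len ((D.next ^ n) o) = D.len o := by
  induction n with
  | zero => simp
  | succ n ih => rw [pow_succ', Equiv.Perm.mul_apply, D.len_next, ih]

theorem e_mul_x (o : O) (n : ℕ) : D.e (D.vtx ((D.next ^ n) o)) * D.x o n = D.x o n := by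
  cases n with
  | zero => simp [D.x_zero, D.e_mul_self]
  | succ n => rw [D.x_succ, ← mul_assoc, pow_succ', Equiv.Perm.mul_apply, D.e_mul_x_one]

theorem e_mul_x_ne (o : O) (n : ℕ) {v : V} (h : v ≠ D.vtx ((D.next ^ n) o)) :
    D.e v * D.x o n = 0 := by
  rw [← D.e_mul_x, ← mul_assoc, D.e_mul_ne _ _ h, zero_mul]

theorem x_mul_x (o : O) (n m : ℕ) : D.x ((D.next ^ n) o) m * D.x o n = D.x o (n + m) := by
  induction m with
  | zero => rw [D.x_zero, D.e_mul_x, add_zero]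
  | succ m ih =>
    rw [D.x_succ, mul_assoc, ih, ← Equiv.Perm.mul_apply, ← pow_add, add_comm m n, ← D.x_succ,
      add_assoc]

theorem x_mul_e (o : O) (n : ℕ) : D.x o n * D.e (D.vtx o) = D.x o n := by
  have := D.x_mul_x o 0 n
  rwa [D.x_zero, pow_zero, Equiv.Perm.one_apply, zero_add] at this

theorem x_mul_e_ne (o : O) (n : ℕ) {v : V} (h : v ≠ D.vtx o) : D.x o n * D.e v = 0 := by
  rw [← D.x_mul_e, mul_assoc, D.e_mul_ne _ _ h.symm, mul_zero]

/-- Only the last arrow of the first path and the first arrow of the second matter, which is why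
both lengths are positive. -/
theorem x_mul_x_ne (o o' : O) (n m : ℕ) (h : o' ≠ (D.next ^ (n + 1)) o) :
    D.x o' (m + 1) * D.x o (n + 1) = 0 := by
  have h1 := D.x_mul_x o' 1 m
  rw [add_comm 1 m] at h1
  rw [← h1, D.x_succ o n, mul_assoc, ← mul_assoc (D.x o' 1), D.x_one_mul_x_one, zero_mul, mul_zero]
  rwa [← Equiv.Perm.mul_apply, ← pow_succ']

theorem x_eq_zero (o : O) (n : ℕ) (h : D.len o < n) : D.x o n = 0 := by
  obtain ⟨k, rfl⟩ := Nat.exists_eq_add_of_lt h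
  rw [add_right_comm, ← D.x_mul_x, D.x_len_succ, mul_zero]

theorem x_len_ne_zero (o : O) : D.x o (D.len o) ≠ 0 := fun h => by
  have := D.form_x o (D.len o)
  simp [h] at this

theorem induction_on {p : A → Prop} (a : A) (he : ∀ v, p (D.e v)) (hx : ∀ o n, p (D.x o (n + 1)))
    (h0 : p 0) (hadd : ∀ a b, p a → p b → p (a + b)) (hsmul : ∀ (c : K) a, p a → p (c • a)) :
    p a := by
  have ha : a ∈ Submodule.span K (Set.range D.e ∪ {y | ∃ o n, y = D.x o n}) := by
    rw [D.span_eq_top]; trivial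
  refine Submodule.span_induction ?_ h0 (fun a b _ _ => hadd a b) (fun c a _ => hsmul c a) ha
  rintro _ (⟨v, rfl⟩ | ⟨o, n, rfl⟩)
  · exact he v
  · cases n with
    | zero => rw [D.x_zero]; exact he _
    | succ n => exact hx o n

/-- The span of the paths of length greater than `k`. -/
def pathsGT (k : ℕ) : Submodule K A := Submodule.span K {y | ∃ o n, k < n ∧ y = D.x o n}

/-- The span of the paths of positive length. -/
def rad : Submodule K A := D.pathsGT 0

theorem x_mem_pathsGT (o : O) {n k : ℕ} (h : k < n) : D.x o n ∈ D.pathsGT k :=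
  Submodule.subset_span ⟨o, n, h, rfl⟩

theorem x_mem_rad (o : O) (n : ℕ) : D.x o (n + 1) ∈ D.rad := D.x_mem_pathsGT o n.succ_pos

theorem pathsGT_induction {k : ℕ} {p : A → Prop} {a : A} (ha : a ∈ D.pathsGT k)
    (hx : ∀ o n, k ≤ n → p (D.x o (n + 1)))
    (h0 : p 0) (hadd : ∀ a b, p a → p b → p (a + b)) (hsmul : ∀ (c : K) a, p a → p (c • a)) :
    p a := by
  refine Submodule.span_induction ?_ h0 (fun a b _ _ => hadd a b) (fun c a _ => hsmul c a) ha
  rintro _ ⟨o, n, hn, rfl⟩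
  obtain ⟨m, rfl⟩ := Nat.exists_eq_succ_of_ne_zero (by omega : n ≠ 0)
  exact hx o m (by omega)

theorem mul_mem_pathsGT (a : A) {b : A} {k : ℕ} (hb : b ∈ D.pathsGT k) : a * b ∈ D.pathsGT k := by
  classical
  refine D.pathsGT_induction (p := fun b => a * b ∈ D.pathsGT k) hb
    (fun o n hn => ?_) (by simp)
    (fun b b' h h' => by rw [mul_add]; exact add_mem h h')
    (fun c b h => by rw [mul_smul_comm]; exact Submodule.smul_mem _ _ h)
  refine D.induction_on (p := fun a => a * D.x o (n + 1) ∈ D.pathsGT k) a (fun v => ?_)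
    (fun o' m => ?_) (by simp)
    (fun b b' h h' => by rw [add_mul]; exact add_mem h h')
    (fun c b h => by rw [smul_mul_assoc]; exact Submodule.smul_mem _ _ h)
  · by_cases h : v = D.vtx ((D.next ^ (n + 1)) o)
    · rw [h, D.e_mul_x]
      exact D.x_mem_pathsGT _ (by omega)
    · rw [D.e_mul_x_ne _ _ h]; simp
  · by_cases h : o' = (D.next ^ (n + 1)) o
    · rw [h, D.x_mul_x]
      exact D.x_mem_pathsGT _ (by omega)
    · rw [D.x_mul_x_ne _ _ _ _ h]; simp

theorem mul_mem_pathsGT_succ {a b : A} {k : ℕ} (ha : a ∈ D.rad) (hb : b ∈ D.pathsGT k) :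
    a * b ∈ D.pathsGT (k + 1) := by
  classical
  refine D.pathsGT_induction (p := fun b => a * b ∈ D.pathsGT (k + 1)) hb
    (fun o n hn => ?_) (by simp)
    (fun b b' h h' => by rw [mul_add]; exact add_mem h h')
    (fun c b h => by rw [mul_smul_comm]; exact Submodule.smul_mem _ _ h)
  refine D.pathsGT_induction (p := fun a => a * D.x o (n + 1) ∈ D.pathsGT (k + 1)) ha
    (fun o' m _ => ?_) (by simp)
    (fun b b' h h' => by rw [add_mul]; exact add_mem h h')
    (fun c b h => by rw [smul_mul_assoc]; exact Submodule.smul_mem _ _ h)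
  by_cases h : o' = (D.next ^ (n + 1)) o
  · rw [h, D.x_mul_x]
    exact D.x_mem_pathsGT _ (by omega)
  · rw [D.x_mul_x_ne _ _ _ _ h]; simp

theorem mem_rad_mul {a : A} (ha : a ∈ D.rad) (b : A) : a * b ∈ D.rad := by
  refine D.pathsGT_induction (p := fun a => a * b ∈ D.rad) ha (fun o n _ => ?_) (by simp)
    (fun b b' h h' => by rw [add_mul]; exact add_mem h h')
    (fun c b h => by rw [smul_mul_assoc]; exact Submodule.smul_mem _ _ h)
  refine D.induction_on (p := fun b => D.x o (n + 1) * b ∈ D.rad) b (fun v => ?_)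
    (fun o' m => D.mul_mem_pathsGT _ (D.x_mem_rad _ _)) (by simp)
    (fun b b' h h' => by rw [mul_add]; exact add_mem h h')
    (fun c b h => by rw [mul_smul_comm]; exact Submodule.smul_mem _ _ h)
  by_cases h : v = D.vtx o
  · rw [h, D.x_mul_e]
    exact D.x_mem_rad _ _
  · rw [D.x_mul_e_ne _ _ h]; simp

theorem exists_pathsGT_eq_bot [Finite O] : ∃ k, D.pathsGT k = ⊥ := by
  obtain ⟨k, hk⟩ := (Set.finite_range D.len).bddAbove
  refine ⟨k, Submodule.span_eq_bot.2 ?_⟩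
  rintro _ ⟨o, n, hn, rfl⟩
  exact D.x_eq_zero _ _ (lt_of_le_of_lt (hk ⟨o, rfl⟩) hn)

theorem isNilpotent_of_mem_rad [Finite O] {j : A} (hj : j ∈ D.rad) : IsNilpotent j := by
  obtain ⟨k, hk⟩ := D.exists_pathsGT_eq_bot
  have : ∀ n, j ^ (n + 1) ∈ D.pathsGT n := by
    intro n
    induction n with
    | zero => rw [zero_add, pow_one]; exact hj
    | succ n ih => rw [pow_succ']; exact D.mul_mem_pathsGT_succ hj ih
  have h := this k
  rw [hk, Submodule.mem_bot] at h
  exact ⟨_, h⟩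

theorem isUnit_smul_one_add [Finite O] {c : K} (hc : c ≠ 0) {j : A} (hj : j ∈ D.rad) :
    IsUnit (c • 1 + j) := by
  have h1 : IsUnit (c • (1 : A)) := by
    rw [← Algebra.algebraMap_eq_smul_one]
    exact (IsUnit.mk0 c hc).map (algebraMap K A)
  refine (D.isNilpotent_of_mem_rad hj).isUnit_add_left_of_commute h1 ?_
  rw [← Algebra.algebraMap_eq_smul_one]
  exact (Algebra.commutes c j).symm

/-- Modulo `rad` the algebra is spanned by the orthogonal idempotents. The factor `c • 1 + j` is a
unit as soon as `c ≠ 0`, so this takes the place of the locality of `e v A e v`. -/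
theorem exists_mul_e (a : A) (v : V) : ∃ c : K, ∃ j ∈ D.rad, a * D.e v = (c • 1 + j) * D.e v := by
  refine D.induction_on (p := fun a => ∃ c : K, ∃ j ∈ D.rad, a * D.e v = (c • 1 + j) * D.e v) a
    (fun v' => ?_)
    (fun o n => ⟨0, _, D.x_mem_rad o n, by simp⟩)
    ⟨0, 0, by simp⟩ ?_ ?_
  · by_cases h : v' = v
    · subst h
      exact ⟨1, 0, by simp, by simp [D.e_mul_self]⟩
    · exact ⟨0, 0, by simp, by simp [D.e_mul_ne _ _ h]⟩
  · rintro a b ⟨c, j, hj, h⟩ ⟨c', j', hj', h'⟩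
    exact ⟨c + c', j + j', add_mem hj hj', by rw [add_mul, h, h', ← add_mul, add_smul]; abel_nf⟩
  · rintro k a ⟨c, j, hj, h⟩
    refine ⟨k * c, k • j, Submodule.smul_mem _ _ hj, ?_⟩
    rw [smul_mul_assoc, h, ← smul_mul_assoc, smul_add, smul_smul]

theorem e_mul_e_mem_rad (a : A) {v v' : V} (h : v ≠ v') : D.e v * a * D.e v' ∈ D.rad := by
  obtain ⟨c, j, hj, hc⟩ := D.exists_mul_e a v'
  rw [mul_assoc, hc, add_mul, mul_add, smul_mul_assoc, one_mul, mul_smul_comm, D.e_mul_ne _ _ h,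
    smul_zero, zero_add]
  exact D.mul_mem_pathsGT _ (D.mem_rad_mul hj _)

theorem e_ne_zero (v : V) : D.e v ≠ 0 := fun h => by
  obtain ⟨o, rfl⟩ := D.vtx_surjective v
  apply D.x_len_ne_zero o
  rw [← D.x_mul_e, h, mul_zero]

theorem e_notMem_rad [Finite O] (v : V) : D.e v ∉ D.rad := fun h => by
  obtain ⟨n, hn⟩ := D.isNilpotent_of_mem_rad h
  have h1 : ∀ n, D.e v ^ (n + 1) = D.e v := by
    intro n
    induction n with
    | zero => simp
    | succ n ih => rw [pow_succ, ih, D.e_mul_self]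
  apply D.e_ne_zero v
  rw [← h1 n, pow_succ, hn, zero_mul]

/-- The coefficient of the path `x o k` in an element, for `0 < k < len o`. -/
def coef (o : O) (k : ℕ) : A →ₗ[K] K :=
  D.form ∘ₗ LinearMap.mulLeft K (D.x ((D.next ^ k) o) (D.len o - k))

theorem coef_apply (o : O) (k : ℕ) (a : A) :
    D.coef o k a = D.form (D.x ((D.next ^ k) o) (D.len o - k) * a) := rfl

theorem coef_x_self {o : O} {k : ℕ} (hk : k ≤ D.len o) :
    D.coef o k (D.x o k) = 1 := by
  rw [coef_apply, D.x_mul_x, D.form_x, if_pos (by omega)]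

/-- The product is zero or a path of length `n + 1 + (len o - k)`, which is maximal only if `n + 1 =
k`; then injectivity of `next ^ k` recovers the first arrow. The bound `k < len o` is strict because
for `k = len o` the multiplier is an idempotent, which cannot detect the first arrow. -/
theorem coef_x_ne {o o' : O} {k n : ℕ} (hk' : k < D.len o) (h : ¬ (o = o' ∧ k = n + 1)) :
    D.coef o k (D.x o' (n + 1)) = 0 := by
  rw [coef_apply]
  obtain ⟨m, hm⟩ := Nat.exists_eq_succ_of_ne_zero (by omega : D.len o - k ≠ 0)
  by_cases h1 : (D.next ^ k) o = (D.next ^ (n + 1)) o'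
  · have h2 : D.len o = D.len o' := by rw [← D.len_pow k o, h1, D.len_pow]
    rw [h1, D.x_mul_x, D.form_x, if_neg]
    intro h3
    have h4 : k = n + 1 := by omega
    rw [← h4] at h1
    exact h ⟨(D.next ^ k).injective h1, h4⟩
  · rw [hm, D.x_mul_x_ne _ _ _ _ h1, map_zero]

/-- The span of the paths of maximal length. -/
def top : Submodule K A := Submodule.span K (Set.range fun o => D.x o (D.len o))

theorem mem_top_of_coef_eq_zero [Finite O] {b : A} (hb : b ∈ D.rad)
    (h : ∀ o k, 0 < k → k < D.len o → D.coef o k b = 0) : b ∈ D.top := by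
  classical
  have := Fintype.ofFinite O
  -- On `rad`, `p` extracts the nonmaximal part: it fixes nonmaximal paths of positive length and
  -- kills maximal ones.
  let p : A →ₗ[K] A := ∑ o, ∑ k ∈ Finset.Ioo 0 (D.len o), (D.coef o k).smulRight (D.x o k)
  have key : b - p b ∈ D.top := by
    refine D.pathsGT_induction (p := fun b => b - p b ∈ D.top) hb (fun o n _ => ?_) (by simp)
      (fun b b' h h' => by rw [map_add, add_sub_add_comm]; exact add_mem h h')
      (fun c b h => by rw [map_smul, ← smul_sub]; exact Submodule.smul_mem _ _ h)
    rcases lt_trichotomy (n + 1) (D.len o) with hn | hn | hn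
    · have : p (D.x o (n + 1)) = D.x o (n + 1) := by
        simp only [p, LinearMap.sum_apply, LinearMap.smulRight_apply]
        rw [Finset.sum_eq_single o]
        · rw [Finset.sum_eq_single (n + 1)]
          · rw [D.coef_x_self hn.le, one_smul]
          · intro k hk hk'
            rw [D.coef_x_ne (Finset.mem_Ioo.1 hk).2 (fun h => hk' h.2), zero_smul]
          · intro h
            exact absurd (Finset.mem_Ioo.2 ⟨by omega, hn⟩) h
        · intro o' _ ho'
          refine Finset.sum_eq_zero fun k hk => ?_
          rw [D.coef_x_ne (Finset.mem_Ioo.1 hk).2 (fun h => ho' h.1), zero_smul]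
        · simp
      rw [this, sub_self]
      exact zero_mem _
    · have : p (D.x o (n + 1)) = 0 := by
        simp only [p, LinearMap.sum_apply, LinearMap.smulRight_apply]
        refine Finset.sum_eq_zero fun o' _ => Finset.sum_eq_zero fun k hk => ?_
        have hk := Finset.mem_Ioo.1 hk
        rw [D.coef_x_ne hk.2, zero_smul]
        rintro ⟨rfl, h⟩
        omega
      rw [this, sub_zero, hn]
      exact Submodule.subset_span ⟨o, rfl⟩
    · rw [D.x_eq_zero _ _ hn]
      simp
  have hp : p b = 0 := by
    simp only [p, LinearMap.sum_apply, LinearMap.smulRight_apply]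
    refine Finset.sum_eq_zero fun o' _ => Finset.sum_eq_zero fun k hk => ?_
    have hk := Finset.mem_Ioo.1 hk
    rw [h _ _ hk.1 hk.2, zero_smul]
  rwa [hp, sub_zero] at key

/-- All paths occurring in `a * x o' 1` start with the arrow `o'`. -/
theorem coef_mul_x_one {o o' : O} (h : o ≠ o') {k : ℕ} (hk : k < D.len o) (a : A) :
    D.coef o k (a * D.x o' 1) = 0 := by
  refine D.induction_on (p := fun a => D.coef o k (a * D.x o' 1) = 0) a
    (fun v => ?_) (fun o'' n => ?_) (by simp)
    (fun b b' h h' => by rw [add_mul, map_add, h, h', add_zero])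
    (fun c b h => by rw [smul_mul_assoc, map_smul, h, smul_zero])
  · by_cases hv : v = D.vtx ((D.next ^ 1) o')
    · rw [hv, D.e_mul_x, D.coef_x_ne hk (fun h' => h h'.1)]
    · rw [D.e_mul_x_ne _ _ hv, map_zero]
  · by_cases hv : o'' = (D.next ^ (0 + 1)) o'
    · rw [hv, D.x_mul_x, ← add_assoc, D.coef_x_ne hk (fun h' => h h'.1)]
    · rw [D.x_mul_x_ne _ _ _ _ hv, map_zero]

theorem coef_eq_zero_of_mem_top {b : A} (hb : b ∈ D.top) (o : O) {k : ℕ} (hk : k < D.len o) :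
    D.coef o k b = 0 := by
  refine Submodule.span_induction (p := fun b _ => D.coef o k b = 0) ?_ (by simp)
    (fun a b _ _ h h' => by rw [map_add, h, h', add_zero])
    (fun c a _ h => by rw [map_smul, h, smul_zero]) hb
  rintro _ ⟨o', rfl⟩
  have := D.two_le_len o'
  obtain ⟨m, hm⟩ := Nat.exists_eq_succ_of_ne_zero (by omega : D.len o' ≠ 0)
  simp only [hm]
  rw [D.coef_x_ne hk]
  rintro ⟨rfl, h⟩
  omega

theorem rad_mul_top {j b : A} (hj : j ∈ D.rad) (hb : b ∈ D.top) : j * b = 0 := by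
  refine Submodule.span_induction (p := fun b _ => j * b = 0) ?_ (by simp)
    (fun a b _ _ h h' => by rw [mul_add, h, h', add_zero])
    (fun c a _ h => by rw [mul_smul_comm, h, smul_zero]) hb
  rintro _ ⟨o, rfl⟩
  refine D.pathsGT_induction (p := fun j => j * D.x o (D.len o) = 0) hj (fun o' n _ => ?_) (by simp)
    (fun b b' h h' => by rw [add_mul, h, h', add_zero])
    (fun c b h => by rw [smul_mul_assoc, h, smul_zero])
  have := D.two_le_len o
  obtain ⟨m, hm⟩ := Nat.exists_eq_succ_of_ne_zero (by omega : D.len o ≠ 0)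
  simp only [hm]
  by_cases h : o' = (D.next ^ (m + 1)) o
  · rw [h, D.x_mul_x, D.x_eq_zero _ _ (by omega)]
  · rw [D.x_mul_x_ne _ _ _ _ h]

theorem finiteDimensional (D : CyclicPathData K A V O) [Finite O] : FiniteDimensional K A := by
  obtain ⟨k, hk⟩ := (Set.finite_range D.len).bddAbove
  let s : Set A := Set.range D.e ∪ (Set.range fun p : O × Fin (k + 1) => D.x p.1 p.2)
  have hs : s.Finite := (Set.finite_range _).union (Set.finite_range _)
  refine ⟨⟨hs.toFinset, ?_⟩⟩
  rw [Set.Finite.coe_toFinset, eq_top_iff]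
  rintro a -
  refine D.induction_on a (fun v => Submodule.subset_span (Or.inl ⟨v, rfl⟩)) (fun o n => ?_)
    (zero_mem _) (fun _ _ => add_mem) (fun c _ h => Submodule.smul_mem _ c h)
  by_cases h : n + 1 < k + 1
  · exact Submodule.subset_span (Or.inr ⟨(o, ⟨n + 1, h⟩), rfl⟩)
  · have : D.len o ≤ k := hk ⟨o, rfl⟩
    rw [D.x_eq_zero _ _ (by omega)]
    exact zero_mem _

end CyclicPathData

/-! ### Radical and socle of the projective module at a vertex -/

namespace CyclicPathData

variable {K : Type w} {A : Type u} [Field K] [Ring A] [Algebra K A]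
    {V : Type v} [Fintype V] {O : Type z} (D : CyclicPathData K A V O)
    {M : Type t} [AddCommGroup M] [Module A M]

/-- The multiples of an element of a module by the paths of positive length. -/
def radSMul (m : M) : Submodule A M where
  carrier := {y | ∃ j ∈ D.rad, j • m = y}
  add_mem' := by
    rintro _ _ ⟨j, hj, rfl⟩ ⟨j', hj', rfl⟩
    exact ⟨j + j', add_mem hj hj', add_smul _ _ _⟩
  zero_mem' := ⟨0, zero_mem _, zero_smul _ _⟩
  smul_mem' := by
    rintro a _ ⟨j, hj, rfl⟩
    exact ⟨a * j, D.mul_mem_pathsGT a hj, mul_smul _ _ _⟩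

/-- The two cases are `c = 0` and `c ≠ 0` in `exists_mul_e`. This makes the module generated by `m`
local. -/
theorem smul_mem_radSMul_or [Finite O] {m : M} {v : V} (hm : D.e v • m = m) (a : A) :
    a • m ∈ D.radSMul m ∨ ∃ b : A, b • a • m = m := by
  obtain ⟨c, j, hj, h⟩ := D.exists_mul_e a v
  have ha : a • m = (c • 1 + j) • m := by
    rw [← hm, ← mul_smul, h, mul_smul]
  rcases eq_or_ne c 0 with rfl | hc
  · left
    exact ⟨j, hj, by rw [ha, zero_smul, zero_add]⟩
  · right
    obtain ⟨u, hu⟩ := D.isUnit_smul_one_add hc hj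
    exact ⟨↑u⁻¹, by rw [ha, ← hu, ← mul_smul, Units.inv_mul, one_smul]⟩

/-- Nakayama's lemma for a cyclic module: if `j • m = m` with `j` nilpotent, then the unit `1 - j`
kills `m`. -/
theorem notMem_radSMul_self [Finite O] {m : M} (hm : m ≠ 0) : m ∉ D.radSMul m := by
  rintro ⟨j, hj, h⟩
  obtain ⟨u, hu⟩ := (D.isNilpotent_of_mem_rad hj).isUnit_one_sub
  apply hm
  have : (u : A) • m = 0 := by rw [hu, sub_smul, one_smul, h, sub_self]
  rw [← one_smul A m, ← Units.inv_mul u, mul_smul, this, smul_zero]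

theorem isSimpleModule_span_singleton [Finite O] {m : M} (hm0 : m ≠ 0) {v : V}
    (hm : D.e v • m = m) (h : ∀ j ∈ D.rad, j • m = 0) :
    IsSimpleModule A (Submodule.span A {m}) := by
  rw [isSimpleModule_iff_isAtom]
  refine ⟨by simpa using hm0, fun N hN => ?_⟩
  by_contra hN0
  obtain ⟨y, hy, hy0⟩ := (Submodule.ne_bot_iff N).1 hN0
  obtain ⟨a, rfl⟩ := Submodule.mem_span_singleton.1 (hN.le hy)
  rcases D.smul_mem_radSMul_or hm a with ⟨j, hj, hj'⟩ | ⟨b, hb⟩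
  · rw [h j hj] at hj'
    exact hy0 hj'.symm
  · refine hN.not_ge ?_
    rw [Submodule.span_singleton_le_iff_mem, ← hb]
    exact N.smul_mem _ hy

/-- Uniseriality comes from here: a path of positive length can be prolonged by a single arrow only,
so `rad` carries it into the multiples of the next longer path. -/
theorem exists_rad_mul_x {j : A} (hj : j ∈ D.rad) (o : O) (n : ℕ) :
    ∃ a, j * D.x o (n + 1) = a * D.x o (n + 2) := by
  refine D.pathsGT_induction (p := fun j => ∃ a, j * D.x o (n + 1) = a * D.x o (n + 2)) hj
    (fun o' k _ => ?_) ⟨0, by simp⟩ ?_ ?_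
  · by_cases h : o' = (D.next ^ (n + 1)) o
    · refine ⟨D.x ((D.next ^ (n + 2)) o) k, ?_⟩
      rw [h, D.x_mul_x, D.x_mul_x]
      congr 1
      omega
    · exact ⟨0, by rw [D.x_mul_x_ne _ _ _ _ h, zero_mul]⟩
  · rintro b b' ⟨a, h⟩ ⟨a', h'⟩
    exact ⟨a + a', by rw [add_mul, h, h', add_mul]⟩
  · rintro c b ⟨a, h⟩
    exact ⟨c • a, by rw [smul_mul_assoc, h, smul_mul_assoc]⟩

theorem isUniserialModule_span_x_smul [Finite O] (o : O) (m : M) :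
    IsUniserialModule A (Submodule.span A {D.x o 1 • m}) := by
  -- The chain is indexed by length minus one, so its term of index `len o` is generated by a path
  -- of length `len o + 1` and vanishes.
  refine isUniserialModule_of_chain (fun k => Submodule.span A {D.x o (k + 1) • m}) (D.len o) ?_
    (fun k N hN => ?_) (antitone_nat_of_succ_le fun k => ?_)
  · simp [D.x_len_succ]
  · have he : D.e (D.vtx ((D.next ^ (k + 1)) o)) • D.x o (k + 1) • m = D.x o (k + 1) • m := by
      rw [← mul_smul, D.e_mul_x]
    by_cases h : ∃ a : A, a • D.x o (k + 1) • m ∈ N ∧ ∃ b : A, b • a • D.x o (k + 1) • m =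
        D.x o (k + 1) • m
    · obtain ⟨a, ha, b, hb⟩ := h
      refine Or.inl (le_antisymm hN ?_)
      rw [Submodule.span_singleton_le_iff_mem, ← hb]
      exact N.smul_mem _ ha
    · right
      intro y hy
      obtain ⟨a, rfl⟩ := Submodule.mem_span_singleton.1 (hN hy)
      rcases D.smul_mem_radSMul_or he a with ⟨j, hj, hj'⟩ | hb
      · obtain ⟨a', ha'⟩ := D.exists_rad_mul_x hj o k
        rw [← hj', ← mul_smul, ha', mul_smul]
        exact Submodule.smul_mem _ _ (Submodule.mem_span_singleton_self _)
      · exact absurd ⟨a, hy, hb⟩ h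
  · rw [Submodule.span_singleton_le_iff_mem, D.x_succ o (k + 1), mul_smul]
    exact Submodule.smul_mem _ _ (Submodule.mem_span_singleton_self _)

theorem mul_mem_top (a : A) {b : A} (hb : b ∈ D.top) : a * b ∈ D.top := by
  refine D.induction_on (p := fun a => a * b ∈ D.top) a (fun v => ?_)
    (fun o n => by rw [D.rad_mul_top (D.x_mem_rad o n) hb]; exact zero_mem _) (by simp)
    (fun b b' h h' => by rw [add_mul]; exact add_mem h h')
    (fun c b h => by rw [smul_mul_assoc]; exact Submodule.smul_mem _ _ h)
  refine Submodule.span_induction (p := fun b _ => D.e v * b ∈ D.top) ?_ (by simp)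
    (fun a b _ _ h h' => by rw [mul_add]; exact add_mem h h')
    (fun c a _ h => by rw [mul_smul_comm]; exact Submodule.smul_mem _ _ h) hb
  rintro _ ⟨o, rfl⟩
  by_cases h : v = D.vtx ((D.next ^ D.len o) o)
  · simp only [h, D.e_mul_x]
    exact Submodule.subset_span ⟨o, rfl⟩
  · simp only [D.e_mul_x_ne _ _ h]
    exact zero_mem _

/-- The element `m` generates a module isomorphic to the projective module at the vertex `v`. -/
structure IsVertexGenerator (v : V) (m : M) : Prop where
  exists_smul_eq : ∀ y : M, ∃ a : A, a • m = y
  e_smul : D.e v • m = m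
  mul_e_eq_zero : ∀ a : A, a • m = 0 → a * D.e v = 0

namespace IsVertexGenerator

variable {D} {v : V} {m : M}

theorem ne_zero (h : D.IsVertexGenerator v m) : m ≠ 0 := fun h0 => by
  have := h.mul_e_eq_zero 1 (by rw [h0, smul_zero])
  rw [one_mul] at this
  exact D.e_ne_zero v this

theorem map {M' : Type y} [AddCommGroup M'] [Module A M'] (h : D.IsVertexGenerator v m)
    (f : M ≃ₗ[A] M') : D.IsVertexGenerator v (f m) where
  exists_smul_eq y := by
    obtain ⟨a, ha⟩ := h.exists_smul_eq (f.symm y)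
    exact ⟨a, by rw [← map_smul, ha, LinearEquiv.apply_symm_apply]⟩
  e_smul := by rw [← map_smul, h.e_smul]
  mul_e_eq_zero a ha := h.mul_e_eq_zero a (by rwa [← map_smul, map_eq_zero_iff _ f.injective] at ha)

theorem smul_eq_smul_iff (h : D.IsVertexGenerator v m) (a b : A) :
    a • m = b • m ↔ a * D.e v = b * D.e v := by
  constructor
  · intro hab
    rw [← sub_eq_zero, ← sub_mul]
    exact h.mul_e_eq_zero _ (by rw [sub_smul, hab, sub_self])
  · intro hab
    rw [← h.e_smul, ← mul_smul, hab, mul_smul]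

theorem nonempty_linearEquiv {M' : Type y} [AddCommGroup M'] [Module A M'] {m' : M'}
    (h : D.IsVertexGenerator v m) (h' : D.IsVertexGenerator v m') : Nonempty (M ≃ₗ[A] M') := by
  have hk : ∀ {M : Type _} [AddCommGroup M] [Module A M] {m : M}, D.IsVertexGenerator v m →
      LinearMap.ker (LinearMap.toSpanSingleton A M m) =
        LinearMap.ker (LinearMap.toSpanSingleton A A (D.e v)) := fun hm => by
    ext a
    have := hm.smul_eq_smul_iff a 0
    simpa using this
  have hs : Function.Surjective (LinearMap.toSpanSingleton A M m) := h.exists_smul_eq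
  have hs' : Function.Surjective (LinearMap.toSpanSingleton A M' m') := h'.exists_smul_eq
  have hk' : LinearMap.ker (LinearMap.toSpanSingleton A M' m') =
      LinearMap.ker (LinearMap.toSpanSingleton A A (D.e v)) := by
    ext a
    simpa using h'.smul_eq_smul_iff a 0
  exact ⟨(LinearMap.quotKerEquivOfSurjective _ hs).symm.trans
    ((Submodule.quotEquivOfEq _ _ ((hk h).trans hk'.symm)).trans
      (LinearMap.quotKerEquivOfSurjective _ hs'))⟩

/-- If the vertices differed, expressing each generator by the other would write `e v` as a product
through `e v'`, hence as an element of `rad`; but a nonzero idempotent is not nilpotent. -/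
theorem vertex_unique [Finite O] {v' : V} {m' : M} (h : D.IsVertexGenerator v m)
    (h' : D.IsVertexGenerator v' m') : v = v' := by
  by_contra hv
  obtain ⟨b, hb⟩ := h.exists_smul_eq m'
  obtain ⟨c, hc⟩ := h'.exists_smul_eq m
  have h1 : (c * D.e v' * b * D.e v) • m = (1 : A) • m := by
    rw [mul_smul, h.e_smul, mul_smul, hb, mul_smul, h'.e_smul, hc, one_smul]
  rw [h.smul_eq_smul_iff, one_mul, mul_assoc _ (D.e v), D.e_mul_self] at h1
  apply D.e_notMem_rad v
  rw [← h1, mul_assoc c, mul_assoc c]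
  exact D.mul_mem_pathsGT _ (D.e_mul_e_mem_rad b (Ne.symm hv))

theorem le_radSMul_or_eq_top [Finite O] (h : D.IsVertexGenerator v m) (N : Submodule A M) :
    N ≤ D.radSMul m ∨ N = ⊤ := by
  by_cases hN : m ∈ N
  · right
    rw [eq_top_iff]
    rintro y -
    obtain ⟨a, rfl⟩ := h.exists_smul_eq y
    exact N.smul_mem _ hN
  · left
    intro y hy
    obtain ⟨a, rfl⟩ := h.exists_smul_eq y
    refine (D.smul_mem_radSMul_or h.e_smul a).resolve_right ?_
    rintro ⟨b, hb⟩
    exact hN (hb ▸ N.smul_mem _ hy)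

theorem jacobson_eq [Finite O] (h : D.IsVertexGenerator v m) :
    Module.jacobson A M = D.radSMul m := by
  refine jacobson_eq_of_isCoatom ⟨?_, fun N hN => ?_⟩ h.le_radSMul_or_eq_top
  · intro h1
    exact D.notMem_radSMul_self h.ne_zero (h1 ▸ Submodule.mem_top)
  · exact (h.le_radSMul_or_eq_top N).resolve_left hN.not_ge

theorem x_smul_eq_zero (h : D.IsVertexGenerator v m) {o : O} (n : ℕ) (ho : D.vtx o ≠ v) :
    D.x o n • m = 0 := by
  rw [← h.e_smul, ← mul_smul, D.x_mul_e_ne _ _ (Ne.symm ho), zero_smul]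

variable {ι : Type y} {s : ι → O}

theorem jacobson_eq_iSup [Finite O] (h : D.IsVertexGenerator v m)
    (hs : ∀ o, D.vtx o = v ↔ ∃ i, s i = o) :
    Module.jacobson A M = ⨆ i, Submodule.span A {D.x (s i) 1 • m} := by
  rw [h.jacobson_eq]
  apply le_antisymm
  · rintro _ ⟨j, hj, rfl⟩
    refine D.pathsGT_induction (p := fun j => j • m ∈ _) hj (fun o n _ => ?_) (by simp)
      (fun b b' h h' => by rw [add_smul]; exact add_mem h h') (fun c b h => ?_)
    · by_cases ho : D.vtx o = v
      · obtain ⟨i, rfl⟩ := (hs o).1 ho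
        refine Submodule.mem_iSup_of_mem i ?_
        rw [add_comm, ← D.x_mul_x, mul_smul]
        exact Submodule.smul_mem _ _ (Submodule.mem_span_singleton_self _)
      · rw [h.x_smul_eq_zero _ ho]
        exact zero_mem _
    · rw [← one_mul b, ← smul_mul_assoc, mul_smul]
      exact Submodule.smul_mem _ _ h
  · refine iSup_le fun i => ?_
    rw [Submodule.span_singleton_le_iff_mem]
    exact ⟨_, D.x_mem_rad _ 0, rfl⟩

theorem x_len_smul_ne_zero (h : D.IsVertexGenerator v m) {o : O} (ho : D.vtx o = v) :
    D.x o (D.len o) • m ≠ 0 := fun h0 => by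
  have := h.mul_e_eq_zero _ h0
  rw [← ho, D.x_mul_e] at this
  exact D.x_len_ne_zero o this

theorem isSimpleModule_span [Finite O] (h : D.IsVertexGenerator v m) {o : O} (ho : D.vtx o = v) :
    IsSimpleModule A (Submodule.span A {D.x o (D.len o) • m}) := by
  refine D.isSimpleModule_span_singleton (v := D.vtx ((D.next ^ D.len o) o))
    (h.x_len_smul_ne_zero ho) (by rw [← mul_smul, D.e_mul_x]) fun j hj => ?_
  rw [← mul_smul, D.rad_mul_top hj (Submodule.subset_span ⟨o, rfl⟩), zero_smul]

theorem smul_mem_span (h : D.IsVertexGenerator v m) {o : O} (ho : D.vtx o = v) {b : A}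
    (hb : b ∈ D.top) : b • m ∈ Submodule.span A {D.x o (D.len o) • m} := by
  refine Submodule.span_induction (p := fun b _ => b • m ∈ _) ?_ (by simp)
    (fun a b _ _ h h' => by rw [add_smul]; exact add_mem h h') (fun c a _ h => ?_) hb
  · rintro _ ⟨o', rfl⟩
    by_cases ho' : D.vtx o' = v
    · simp only [D.x_len_eq o' o (ho'.trans ho.symm)]
      exact Submodule.mem_span_singleton_self _
    · simp only [h.x_smul_eq_zero _ ho']
      exact zero_mem _
  · rw [← one_mul a, ← smul_mul_assoc, mul_smul]
    exact Submodule.smul_mem _ _ h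

theorem mul_e_mem_top (h : D.IsVertexGenerator v m) {o : O} (ho : D.vtx o = v) {b : A}
    (hb : b • m ∈ Submodule.span A {D.x o (D.len o) • m}) : b * D.e v ∈ D.top := by
  obtain ⟨a, ha⟩ := Submodule.mem_span_singleton.1 hb
  rw [← mul_smul, h.smul_eq_smul_iff, ← ho, mul_assoc, D.x_mul_e] at ha
  rw [← ho, ← ha]
  exact D.mul_mem_top _ (Submodule.subset_span ⟨o, rfl⟩)

/-- By Nakayama, `rad` annihilates every simple submodule `N`, and `N` lies in the radical because
`rad` does not annihilate `m`. The path completing a nonmaximal path has positive length and so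
annihilates `N`; hence all nonmaximal coefficients of elements of `N` vanish. -/
theorem socle_eq [Finite O] (h : D.IsVertexGenerator v m) {o : O} (ho : D.vtx o = v) :
    moduleSocle A M = Submodule.span A {D.x o (D.len o) • m} := by
  refine le_antisymm (sSup_le fun N hN => ?_) (le_sSup (h.isSimpleModule_span ho))
  have hN : IsSimpleModule A N := hN
  rw [isSimpleModule_iff_isAtom] at hN
  have hz : ∀ y ∈ N, ∀ j ∈ D.rad, j • y = 0 := by
    intro y hy j hj
    rcases eq_or_ne y 0 with rfl | hy0
    · simp
    have h1 : D.radSMul y ≤ N := by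
      rintro _ ⟨j, -, rfl⟩
      exact N.smul_mem _ hy
    rcases hN.le_iff.1 h1 with h2 | h2
    · exact (Submodule.mem_bot A).1 (h2 ▸ ⟨j, hj, rfl⟩)
    · exact absurd (h2 ▸ hy) (D.notMem_radSMul_self hy0)
  intro y hy
  obtain ⟨b, rfl⟩ := h.exists_smul_eq y
  have hb : b • m ∈ D.radSMul m := by
    refine ((h.le_radSMul_or_eq_top N).resolve_right ?_) hy
    rintro rfl
    refine h.x_len_smul_ne_zero ho (hz m trivial _ ?_)
    exact D.x_mem_pathsGT _ (lt_of_lt_of_le two_pos (D.two_le_len o))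
  obtain ⟨j, hj, hj'⟩ := hb
  rw [← hj'] at hy ⊢
  have he : j • m = (j * D.e v) • m := by rw [mul_smul, h.e_smul]
  rw [he]
  refine h.smul_mem_span ho (D.mem_top_of_coef_eq_zero (D.mem_rad_mul hj _) fun o' k hk hk' => ?_)
  have h1 := hz _ hy (D.x ((D.next ^ k) o') (D.len o' - k)) (D.x_mem_pathsGT _ (by omega))
  rw [← mul_smul] at h1
  rw [coef_apply, ← mul_assoc, h.mul_e_eq_zero _ h1, map_zero]

/-- A nonmaximal path fails to start with `o` or fails to start with `o'`, so a common element has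
no nonmaximal coefficients and lies in the simple socle. -/
theorem inf_eq_bot_or_isSimpleModule [Finite O] (h : D.IsVertexGenerator v m) {o o' : O}
    (ho : D.vtx o = v) (ho' : D.vtx o' = v) (hne : o ≠ o') :
    Submodule.span A {D.x o 1 • m} ⊓ Submodule.span A {D.x o' 1 • m} = ⊥ ∨
      IsSimpleModule A
        ↥(Submodule.span A {D.x o 1 • m} ⊓ Submodule.span A {D.x o' 1 • m}) := by
  have hle : Submodule.span A {D.x o 1 • m} ⊓ Submodule.span A {D.x o' 1 • m} ≤
      Submodule.span A {D.x o (D.len o) • m} := by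
    rintro y ⟨hy, hy'⟩
    obtain ⟨a, rfl⟩ := Submodule.mem_span_singleton.1 hy
    obtain ⟨a', ha'⟩ := Submodule.mem_span_singleton.1 hy'
    have h1 : a * D.x o 1 = a' * D.x o' 1 := by
      rw [← mul_smul, ← mul_smul, h.smul_eq_smul_iff, mul_assoc, mul_assoc] at ha'
      nth_rewrite 1 [← ho'] at ha'
      rw [← ho, D.x_mul_e, D.x_mul_e] at ha'
      exact ha'.symm
    rw [← mul_smul]
    refine h.smul_mem_span ho (D.mem_top_of_coef_eq_zero (D.mul_mem_pathsGT _ (D.x_mem_rad o 0))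
      fun o'' k hk hk' => ?_)
    by_cases h2 : o'' = o
    · rw [h1, D.coef_mul_x_one (h2 ▸ hne) hk']
    · exact D.coef_mul_x_one h2 hk' a
  have hS := h.isSimpleModule_span ho
  rw [isSimpleModule_iff_isAtom] at hS
  rcases hS.le_iff.1 hle with h1 | h1
  · exact Or.inl h1
  · right
    rw [h1]
    exact h.isSimpleModule_span ho

theorem hasMultiserialRadical [Finite O] (h : D.IsVertexGenerator v m) :
    HasMultiserialRadical A M := by
  have hf : Finite {o // D.vtx o = v} := inferInstance
  obtain ⟨n, ⟨f⟩⟩ := Finite.exists_equiv_fin {o // D.vtx o = v}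
  refine ⟨n, fun i => Submodule.span A {D.x (f.symm i).1 1 • m},
    fun i => D.isUniserialModule_span_x_smul _ m, h.jacobson_eq_iSup fun o => ?_, fun i j hij => ?_⟩
  · exact ⟨fun ho => ⟨f ⟨o, ho⟩, by simp⟩, by rintro ⟨i, rfl⟩; exact (f.symm i).2⟩
  · refine h.inf_eq_bot_or_isSimpleModule (f.symm i).2 (f.symm j).2 fun hij' => hij ?_
    exact f.symm.injective (Subtype.ext hij')

end IsVertexGenerator

end CyclicPathData

/-! ### Indecomposable projective modules and their hearts -/

namespace CyclicPathData

variable {K : Type w} {A : Type u} [Field K] [Ring A] [Algebra K A]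
    {V : Type v} [Fintype V] {O : Type z} (D : CyclicPathData K A V O)
    {M : Type t} [AddCommGroup M] [Module A M]

/-- Every indecomposable projective module is isomorphic to the projective module at a vertex. -/
theorem exists_isVertexGenerator [Finite O] (hP : Module.Projective A M)
    (hM : IsIndecomposableModule A M) : ∃ (v : V) (m : M), D.IsVertexGenerator v m := by
  obtain ⟨s, hs⟩ := hP.out
  have key : ∃ x y, s x y ∉ D.rad := by
    by_contra! hc
    -- If all coordinates lay in `rad`, substituting `x = ∑ s x y • y` into itself would put `M`
    -- inside every additive subgroup generated by `pathsGT k • M`, and these are eventually zero.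
    have h1 : ∀ k, ∀ x : M, x ∈ AddSubgroup.closure {y : M | ∃ j ∈ D.pathsGT k, ∃ x, y = j • x} := by
      have h2 : ∀ x : M, x = (s x).sum fun y a => a • y := fun x => (hs x).symm
      intro k
      induction k with
      | zero =>
        intro x
        rw [h2 x]
        exact AddSubgroup.sum_mem _ fun y _ => AddSubgroup.subset_closure ⟨_, hc x y, y, rfl⟩
      | succ k ih =>
        intro x
        rw [h2 x]
        refine AddSubgroup.sum_mem _ fun y _ => ?_
        refine AddSubgroup.closure_induction (p := fun y' _ => s x y • y' ∈ _) ?_ (by simp)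
          (fun a b _ _ h h' => by rw [smul_add]; exact add_mem h h')
          (fun a _ h => by rw [smul_neg]; exact neg_mem h) (ih y)
        rintro _ ⟨j, hj, z, rfl⟩
        exact AddSubgroup.subset_closure ⟨_, D.mul_mem_pathsGT_succ (hc x y) hj, z, smul_smul _ _ _⟩
    obtain ⟨k, hk⟩ := D.exists_pathsGT_eq_bot
    obtain ⟨x, hx⟩ := @exists_ne M hM.1 0
    refine hx ?_
    have h3 := h1 k x
    have h4 : {y : M | ∃ j ∈ D.pathsGT k, ∃ x, y = j • x} ⊆ {0} := by
      rintro _ ⟨j, hj, x, rfl⟩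
      rw [hk, Submodule.mem_bot] at hj
      simp [hj]
    have h5 := AddSubgroup.closure_mono h4 h3
    rwa [AddSubgroup.closure_singleton_zero, AddSubgroup.mem_bot] at h5
  obtain ⟨x, y, hxy⟩ := key
  -- Off-diagonal Peirce components always lie in `rad`, so some diagonal one does not.
  have h1 : ∃ v, D.e v * s x y * D.e v ∉ D.rad := by
    by_contra! hc
    apply hxy
    rw [← mul_one (s x y), ← one_mul (s x y), ← D.sum_e, Finset.sum_mul, Finset.sum_mul]
    refine Submodule.sum_mem _ fun v _ => ?_
    rw [Finset.mul_sum]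
    refine Submodule.sum_mem _ fun v' _ => ?_
    by_cases h : v = v'
    · rw [← h]; exact hc v
    · exact D.e_mul_e_mem_rad _ h
  obtain ⟨v, hv⟩ := h1
  let f : M →ₗ[A] A := (LinearMap.toSpanSingleton A A (D.e v)) ∘ₗ (Finsupp.lapply y) ∘ₗ s
  have hf : ∀ p, f p = s p y * D.e v := fun p => rfl
  have hfe : ∀ p, f p * D.e v = f p := fun p => by rw [hf, mul_assoc, D.e_mul_self]
  obtain ⟨m, hm, hm'⟩ : ∃ m, f m = D.e v ∧ D.e v • m = m := by
    have h2 : ∃ b : A, b * (D.e v * s x y * D.e v) = D.e v := by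
      have h3 := D.smul_mem_radSMul_or (M := A) (m := D.e v) (D.e_mul_self v) (D.e v * s x y)
      refine h3.resolve_left ?_
      rintro ⟨j, hj, hj'⟩
      apply hv
      have hj' : j * D.e v = D.e v * s x y * D.e v := hj'
      rw [← hj']
      exact D.mem_rad_mul hj _
    obtain ⟨b, hb⟩ := h2
    -- Here `b` inverts the diagonal component from the left, so `f` sends this multiple of `x` to
    -- `e v`.
    refine ⟨(D.e v * b * D.e v) • x, ?_, ?_⟩
    · rw [map_smul, hf, smul_eq_mul]
      simp only [mul_assoc] at hb ⊢
      rw [hb, D.e_mul_self]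
    · rw [← mul_smul, ← mul_assoc, ← mul_assoc, D.e_mul_self]
  -- `g` is an idempotent endomorphism fixing `m ≠ 0`. By indecomposability it is injective, hence
  -- the identity, and `m` generates `M`.
  let g : M →ₗ[A] M := (LinearMap.toSpanSingleton A M m) ∘ₗ f
  have hg : ∀ p, g p = f p • m := fun p => rfl
  have hfg : ∀ p, f (g p) = f p := fun p => by
    rw [hg, map_smul, hm, smul_eq_mul, hfe]
  have hm0 : m ≠ 0 := fun h => D.e_ne_zero v (by rw [← hm, h, map_zero])
  have hker : LinearMap.ker g = ⊥ := by
    have hid : IsIdempotentElem g := by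
      ext p
      change g (g p) = g p
      rw [hg (g p), hfg, hg]
    rcases hM.2 _ _ (LinearMap.IsIdempotentElem.isCompl hid) with h | h
    · exfalso
      rw [LinearMap.range_eq_bot] at h
      apply hm0
      have : g m = m := by rw [hg, hm, hm']
      rw [← this, h, LinearMap.zero_apply]
    · exact h
  refine ⟨v, m, fun p => ⟨f p, ?_⟩, hm', fun a ha => ?_⟩
  · apply LinearMap.ker_eq_bot.1 hker
    rw [← hg, hg (g p), hfg, hg]
  · rw [← hm, ← smul_eq_mul, ← map_smul, ha, map_zero]

namespace IsVertexGenerator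

variable {D} {v : V} {m : M} {ι : Type y} {s : ι → O}

/-- The uniserial submodules of the heart generated by arrows. -/
def heartSummand (D : CyclicPathData K A V O) (m : M) (o : O) : Submodule A (ModuleHeart A M) :=
  ((Submodule.span A {D.x o 1 • m}).submoduleOf (Module.jacobson A M)).map
    (Submodule.mkQ _)

theorem mk_eq_zero_iff [Finite O] (h : D.IsVertexGenerator v m) {o : O} (ho : D.vtx o = v)
    (y : Module.jacobson A M) :
    ((moduleSocle A M).submoduleOf (Module.jacobson A M)).mkQ y = 0 ↔
      (y : M) ∈ Submodule.span A {D.x o (D.len o) • m} := by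
  rw [Submodule.mkQ_apply, Submodule.Quotient.mk_eq_zero, ← h.socle_eq ho]
  rfl

theorem mul_x_smul_mem (h : D.IsVertexGenerator v m) [Finite O] (a : A) (o : O) (n : ℕ) :
    (a * D.x o (n + 1)) • m ∈ Module.jacobson A M := by
  rw [h.jacobson_eq]
  exact ⟨_, D.mul_mem_pathsGT a (D.x_mem_rad o n), rfl⟩

theorem mem_heartSummand [Finite O] (h : D.IsVertexGenerator v m) {o : O}
    {y : ModuleHeart A M} : y ∈ heartSummand D m o ↔
      ∃ a : A, Submodule.mkQ _ ⟨(a * D.x o 1) • m, h.mul_x_smul_mem a o 0⟩ = y := by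
  constructor
  · rintro ⟨⟨z, hz⟩, hz', rfl⟩
    obtain ⟨a, rfl⟩ := Submodule.mem_span_singleton.1 hz'
    exact ⟨a, by simp only [mul_smul]⟩
  · rintro ⟨a, rfl⟩
    refine Submodule.mem_map_of_mem ?_
    change (a * D.x o 1) • m ∈ Submodule.span A {D.x o 1 • m}
    rw [mul_smul]
    exact Submodule.smul_mem _ _ (Submodule.mem_span_singleton_self _)

theorem isUniserialModule_heartSummand [Finite O] (o : O) :
    IsUniserialModule A (heartSummand D m o) := by
  have h1 : IsUniserialModule A
      ((Submodule.span A {D.x o 1 • m}).submoduleOf (Module.jacobson A M)) :=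
    (D.isUniserialModule_span_x_smul o m).of_injective
      (((Module.jacobson A M).subtype).restrict fun _ h => h)
      fun a b hab => Subtype.ext (Subtype.ext (by
        have h := congrArg Subtype.val hab
        exact h))
  exact h1.of_surjective ((Submodule.mkQ _).submoduleMap _) (LinearMap.submoduleMap_surjective _ _)

/-- Since `len o ≥ 2`, the arrow is itself a nonmaximal path and has coefficient 1 at length 1, so
it lies outside the socle. -/
theorem nontrivial_heartSummand [Finite O] (h : D.IsVertexGenerator v m) {o : O}
    (ho : D.vtx o = v) : Nontrivial (heartSummand D m o) := by
  rw [Submodule.nontrivial_iff_ne_bot]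
  intro h0
  have h1 := (h.mem_heartSummand (o := o)).2 ⟨1, rfl⟩
  rw [h0, Submodule.mem_bot, h.mk_eq_zero_iff ho] at h1
  change (1 * D.x o 1) • m ∈ _ at h1
  rw [one_mul] at h1
  have h2 := h.mul_e_mem_top ho h1
  rw [← ho, D.x_mul_e] at h2
  have h3 := D.coef_eq_zero_of_mem_top h2 o (k := 1) (D.two_le_len o)
  rw [D.coef_x_self (one_le_two.trans (D.two_le_len o))] at h3
  exact one_ne_zero h3

theorem isInternal_heartSummand [Finite O] [DecidableEq ι] (h : D.IsVertexGenerator v m)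
    (hs : ∀ o, D.vtx o = v ↔ ∃ i, s i = o) (hinj : Function.Injective s) :
    DirectSum.IsInternal fun i => heartSummand D m (s i) := by
  have hsv : ∀ i, D.vtx (s i) = v := fun i => (hs _).2 ⟨i, rfl⟩
  rw [DirectSum.isInternal_submodule_iff_iSupIndep_and_iSup_eq_top]
  constructor
  · rw [iSupIndep_iff_finsetSum_eq_zero_imp_eq_zero]
    intro t y hy hsum i hi
    have h1 : ∀ i, ∃ a : A, i ∈ t → Submodule.mkQ _
        ⟨(a * D.x (s i) 1) • m, h.mul_x_smul_mem a (s i) 0⟩ = y i := by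
      intro i
      by_cases hi : i ∈ t
      · obtain ⟨a, ha⟩ := h.mem_heartSummand.1 (hy i hi)
        exact ⟨a, fun _ => ha⟩
      · exact ⟨0, fun h => absurd h hi⟩
    choose a ha using h1
    rw [← Finset.sum_congr rfl ha, ← map_sum, h.mk_eq_zero_iff (hsv i)] at hsum
    have h2 : (∑ j ∈ t, a j * D.x (s j) 1) • m ∈
        Submodule.span A {D.x (s i) (D.len (s i)) • m} := by
      rw [Finset.sum_smul]
      simpa using hsum
    have h3 := h.mul_e_mem_top (hsv i) h2
    have h4 : (∑ j ∈ t, a j * D.x (s j) 1) * D.e v = ∑ j ∈ t, a j * D.x (s j) 1 := by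
      rw [Finset.sum_mul]
      refine Finset.sum_congr rfl fun j _ => ?_
      rw [mul_assoc, ← hsv j, D.x_mul_e]
    rw [h4] at h3
    rw [← ha i hi, h.mk_eq_zero_iff (hsv i)]
    refine h.smul_mem_span (hsv i) (D.mem_top_of_coef_eq_zero
      (D.mul_mem_pathsGT _ (D.x_mem_rad _ 0)) fun o k hk hk' => ?_)
    -- Coefficients at paths starting with `s i` come from the `i`-th term alone, so they vanish
    -- because the whole sum lies in `top`.
    by_cases ho : o = s i
    · have h5 := D.coef_eq_zero_of_mem_top h3 o hk'
      rw [map_sum, Finset.sum_eq_single i] at h5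
      · exact h5
      · intro j _ hj
        exact D.coef_mul_x_one (fun h' => hj (hinj (h'.symm.trans ho))) hk' _
      · exact fun h' => absurd hi h'
    · exact D.coef_mul_x_one ho hk' _
  · rw [eq_top_iff]
    rintro y -
    obtain ⟨⟨y, hy⟩, rfl⟩ := Submodule.mkQ_surjective _ y
    have hy' := hy
    rw [h.jacobson_eq] at hy'
    obtain ⟨j, hj, rfl⟩ := hy'
    have hmem : ∀ j ∈ D.rad, j • m ∈ Module.jacobson A M := fun j hj => by
      rw [h.jacobson_eq]
      exact ⟨j, hj, rfl⟩
    -- The induction predicate ranges over all of `A`, so it must carry the proof of membership in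
    -- the radical along.
    have key : ∃ hy, Submodule.mkQ ((moduleSocle A M).submoduleOf (Module.jacobson A M))
        ⟨j • m, hy⟩ ∈ ⨆ i, heartSummand D m (s i) := by
      refine D.pathsGT_induction (p := fun j => ∃ hy, Submodule.mkQ
        ((moduleSocle A M).submoduleOf (Module.jacobson A M)) ⟨j • m, hy⟩ ∈
          ⨆ i, heartSummand D m (s i)) hj (fun o n _ => ?_) ?_ ?_ ?_
      · refine ⟨hmem _ (D.x_mem_rad o n), ?_⟩
        by_cases ho : D.vtx o = v
        · obtain ⟨i, rfl⟩ := (hs o).1 ho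
          refine Submodule.mem_iSup_of_mem i (h.mem_heartSummand.2
            ⟨D.x ((D.next ^ 1) (s i)) n, ?_⟩)
          simp only [D.x_mul_x, add_comm 1 n]
        · simp only [h.x_smul_eq_zero _ ho]
          exact zero_mem (⨆ i, heartSummand D m (s i))
      · refine ⟨hmem _ (zero_mem _), ?_⟩
        simp only [zero_smul]
        exact zero_mem (⨆ i, heartSummand D m (s i))
      · rintro a b ⟨ha, ha'⟩ ⟨hb, hb'⟩
        refine ⟨by rw [add_smul]; exact add_mem ha hb, ?_⟩
        simp only [add_smul]
        exact add_mem ha' hb'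
      · rintro c a ⟨ha, ha'⟩
        have hc : (c • a) • m = (c • (1 : A)) • a • m := by
          rw [← mul_smul, smul_mul_assoc, one_mul]
        refine ⟨by rw [hc]; exact Submodule.smul_mem _ _ ha, ?_⟩
        simp only [hc]
        exact Submodule.smul_mem _ (c • (1 : A)) ha'
    exact key.2

theorem isNoetherian_and_isArtinian [Finite O] (h : D.IsVertexGenerator v m) :
    IsNoetherian A M ∧ IsArtinian A M := by
  have := D.finiteDimensional
  have := IsNoetherianRing.of_finite K A
  have := IsArtinianRing.of_finite K A
  have : Module.Finite A M := by
    refine ⟨⟨{m}, ?_⟩⟩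
    rw [Finset.coe_singleton, eq_top_iff]
    rintro y -
    exact Submodule.mem_span_singleton.2 (h.exists_smul_eq y)
  exact ⟨inferInstance, inferInstance⟩

/-- The heart is the direct sum of one nonzero uniserial module for each arrow at the vertex, and
every decomposition of it into indecomposable modules has the same number of summands. -/
theorem heart_decomposition [Finite O] (h : D.IsVertexGenerator v m) {r : ℕ}
    (hr : Nat.card {o // D.vtx o = v} = r) :
    (∃ N : Fin r → Submodule A (ModuleHeart A M), DirectSum.IsInternal N ∧
      ∀ i, Nontrivial (N i) ∧ IsUniserialModule A (N i)) ∧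
    ∀ (n : ℕ) (N : Fin n → Submodule A (ModuleHeart A M)), DirectSum.IsInternal N →
      (∀ i, IsIndecomposableModule A (N i)) → n = r := by
  obtain ⟨hN, hA⟩ := h.isNoetherian_and_isArtinian
  let f : Fin r ≃ {o // D.vtx o = v} := (Finite.equivFinOfCardEq hr).symm
  have h1 := h.isInternal_heartSummand (s := fun i => (f i).1)
    (fun o => ⟨fun ho => ⟨f.symm ⟨o, ho⟩, by simp⟩, by rintro ⟨i, rfl⟩; exact (f i).2⟩)
    (Subtype.val_injective.comp f.injective)
  have h2 : ∀ i, Nontrivial (heartSummand D m (f i).1) := fun i =>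
    h.nontrivial_heartSummand (f i).2
  have h3 : ∀ i, IsUniserialModule A (heartSummand D m (f i).1) := fun i =>
    isUniserialModule_heartSummand _
  refine ⟨⟨_, h1, fun i => ⟨h2 i, h3 i⟩⟩, fun n N hN hN' => ?_⟩
  have := card_eq_of_isInternal_of_isUniserialModule h1 h2 h3 hN hN'
  simpa using this

end IsVertexGenerator

end CyclicPathData

/-! ### Successor sequences, paths and the linear form -/

namespace BrauerConfiguration

variable {Γ₀ : Type u} {Γ₁ : Type v} [DecidableEq Γ₀] [Fintype Γ₁]
  {Γ : BrauerConfiguration Γ₀ Γ₁}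

/-! ### Entries -/

/-- The permutation of the entries that sends each entry to the next one. -/
def nextPerm (Γ : BrauerConfiguration Γ₀ Γ₁) : Equiv.Perm Γ.Entry where
  toFun := Entry.next
  invFun o := ⟨o.vertex, o.nontruncated, (Γ.succ o.vertex).symm o.entry⟩
  left_inv o := congrArg (Entry.mk o.vertex o.nontruncated) (Equiv.symm_apply_apply _ _)
  right_inv o := congrArg (Entry.mk o.vertex o.nontruncated) (Equiv.apply_symm_apply _ _)

theorem nextPerm_apply (o : Γ.Entry) : Γ.nextPerm o = o.next := rfl

theorem nextPerm_pow_apply (o : Γ.Entry) (n : ℕ) : (Γ.nextPerm ^ n) o = o.iter n := by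
  induction n with
  | zero => rfl
  | succ n ih => rw [pow_succ', Equiv.Perm.mul_apply, ih]; rfl

theorem Entry.iter_add (o : Γ.Entry) (m n : ℕ) : o.iter (m + n) = (o.iter m).iter n := by
  rw [← nextPerm_pow_apply, ← nextPerm_pow_apply, ← nextPerm_pow_apply, add_comm, pow_add,
    Equiv.Perm.mul_apply]

theorem Entry.iter_eq (o : Γ.Entry) (n : ℕ) :
    o.iter n = ⟨o.vertex, o.nontruncated, ((Γ.succ o.vertex) ^ n) o.entry⟩ := by
  induction n with
  | zero => rfl
  | succ n ih => rw [Entry.iter, ih, pow_succ']; rfl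

theorem card_entries (α : Γ₀) : Fintype.card (Σ V : Γ₁, Fin ((Γ.polygon V).count α)) = Γ.val α := by
  simp [val, occ]

theorem Entry.iter_val (o : Γ.Entry) : o.iter (Γ.val o.vertex) = o := by
  have h : (Γ.succ o.vertex).IsCycleOn
      (↑(Finset.univ : Finset (Σ V : Γ₁, Fin ((Γ.polygon V).count o.vertex)))) := by
    rw [Finset.coe_univ]; exact Γ.succ_isCycle o.vertex
  have h1 := h.pow_card_apply (Finset.mem_univ o.entry)
  rw [Finset.card_univ, card_entries] at h1
  rw [Entry.iter_eq, h1]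

theorem Entry.val_pos (o : Γ.Entry) : 0 < Γ.val o.vertex := by
  rw [← card_entries]
  exact Fintype.card_pos_iff.2 ⟨o.entry⟩

/-- The length `val(α) μ(α)` of the power `C^{μ(α)}` of a special `α`-cycle. -/
def Entry.len (o : Γ.Entry) : ℕ := Γ.val o.vertex * Γ.mult o.vertex

theorem Entry.two_le_len (o : Γ.Entry) : 2 ≤ o.len := by
  have h1 : o.len ≠ 1 := o.nontruncated
  have h2 : 0 < o.len := Nat.mul_pos o.val_pos (Γ.mult_pos _)
  omega

theorem Entry.len_iter (o : Γ.Entry) (n : ℕ) : (o.iter n).len = o.len := by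
  rw [Entry.iter_eq]; rfl

theorem Entry.iter_val_mul (o : Γ.Entry) (k : ℕ) : o.iter (Γ.val o.vertex * k) = o := by
  induction k with
  | zero => rfl
  | succ k ih => rw [mul_add, mul_one, Entry.iter_add, ih, Entry.iter_val]

theorem Entry.iter_len (o : Γ.Entry) : o.iter o.len = o := o.iter_val_mul _

theorem Entry.next_eq_self (o : Γ.Entry) (h : Γ.val o.vertex = 1) : o.next = o := by
  have := o.iter_val
  rwa [h] at this

/-- The first `n` entries of the successor sequence starting at an entry. -/
def Entry.seq (o : Γ.Entry) (n : ℕ) : List Γ.Entry := (List.range n).map o.iter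

theorem Entry.length_seq (o : Γ.Entry) (n : ℕ) : (o.seq n).length = n := by simp [Entry.seq]

theorem Entry.eq_next_of_seq_eq {o a b : Γ.Entry} {n : ℕ} {l l' : List Γ.Entry}
    (h : o.seq n = l ++ [a, b] ++ l') : b = a.next := by
  have hlen := congrArg List.length h
  simp only [Entry.length_seq, List.length_append, List.length_cons, List.length_nil] at hlen
  have ha : (o.seq n)[l.length]? = some a := by rw [h]; simp
  have hb : (o.seq n)[l.length + 1]? = some b := by rw [h]; simp
  simp only [Entry.seq, List.getElem?_map] at ha hb
  rw [List.getElem?_range (by omega)] at ha hb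
  simp only [Option.map_some, Option.some.injEq] at ha hb
  rw [← ha, ← hb, Entry.iter]

/-- The list of entries runs through a maximal nonzero path. -/
def IsFull (l : List Γ.Entry) : Prop := ∃ o : Γ.Entry, l = o.seq o.len

/-- Valence and multiplicity are constant along a successor sequence, so any entry of a full list
determines its length. The index `n + 1` ensures that `o` occurs in the list. -/
theorem IsFull.length_eq {o : Γ.Entry} {n : ℕ} {l l' : List Γ.Entry}
    (h : IsFull (l ++ o.seq (n + 1) ++ l')) : l.length + (n + 1) + l'.length = o.len := by
  obtain ⟨o', h⟩ := h
  have hlen := congrArg List.length h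
  simp only [Entry.length_seq, List.length_append] at hlen
  have ho : o ∈ o'.seq o'.len := by
    rw [← h]
    simp only [List.mem_append]
    refine Or.inl (Or.inr ?_)
    rw [Entry.seq, List.mem_map]
    exact ⟨0, by simp, rfl⟩
  rw [Entry.seq, List.mem_map] at ho
  obtain ⟨k, -, hk⟩ := ho
  rw [hlen, ← hk, Entry.len_iter]

theorem isFull_append_seq_len_iff {o : Γ.Entry} {l l' : List Γ.Entry} :
    IsFull (l ++ o.seq o.len ++ l') ↔ l = [] ∧ l' = [] := by
  constructor
  · intro h
    obtain ⟨n, hn⟩ := Nat.exists_eq_succ_of_ne_zero (by have := o.two_le_len; omega : o.len ≠ 0)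
    rw [hn] at h
    have := h.length_eq
    exact ⟨List.eq_nil_of_length_eq_zero (by omega), List.eq_nil_of_length_eq_zero (by omega)⟩
  · rintro ⟨rfl, rfl⟩
    exact ⟨o, by simp⟩

theorem isFull_seq_iff {o : Γ.Entry} {n : ℕ} : IsFull (o.seq n) ↔ n = o.len := by
  constructor
  · intro h
    cases n with
    | zero =>
      obtain ⟨o', h⟩ := h
      have h1 := congrArg List.length h
      have := o'.two_le_len
      simp only [Entry.length_seq] at h1
      omega
    | succ n =>
      have h1 : IsFull ([] ++ o.seq (n + 1) ++ []) := by simpa using h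
      simpa using h1.length_eq
  · rintro rfl
    exact ⟨o, rfl⟩

/-! ### Paths -/

/-- The entries of the arrows of a path. -/
def pathEntries {a b : Γ.QVertex} (p : Quiver.Path a b) : List Γ.Entry :=
  @Quiver.Path.rec Γ.QVertex _ a (fun _ _ => List Γ.Entry) []
    (fun {_ _} _ (f : {_o : Γ.Entry // _}) l => l ++ [f.1]) b p

theorem pathEntries_nil (a : Γ.QVertex) : pathEntries (Quiver.Path.nil : Quiver.Path a a) = [] := rfl

theorem pathEntries_cons {a b c : Γ.QVertex} (p : Quiver.Path a b) (f : b ⟶ c) :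
    pathEntries (p.cons f) = pathEntries p ++ [f.1] := rfl

theorem pathEntries_comp {a b c : Γ.QVertex} (p : Quiver.Path a b) (q : Quiver.Path b c) :
    pathEntries (p.comp q) = pathEntries p ++ pathEntries q := by
  induction q with
  | nil => simp [pathEntries_nil]
  | cons q f ih => simp [pathEntries_cons, ih]

theorem pathEntries_path (o : Γ.Entry) (n : ℕ) : pathEntries (o.path n) = o.seq n := by
  induction n with
  | zero => rfl
  | succ n ih =>
    have h : pathEntries (o.path (n + 1)) = pathEntries (o.path n) ++ [o.iter n] := rfl
    rw [h, ih, Entry.seq, Entry.seq, List.range_succ, List.map_append, List.map_singleton]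

theorem exists_path_eq_comp (o : Γ.Entry) (n : ℕ) :
    ∃ r : Quiver.Path (o.iter 2).vtx (o.iter (n + 2)).vtx, o.path (n + 2) = (o.path 2).comp r := by
  induction n with
  | zero => exact ⟨Quiver.Path.nil, rfl⟩
  | succ n ih =>
    obtain ⟨r, hr⟩ := ih
    exact ⟨r.cons (o.iter (n + 2)).arrow, congrArg (fun p => p.cons (o.iter (n + 2)).arrow) hr⟩

theorem eq_next_of_inSpecialCycle {V W X : Γ.QVertex} {a : V ⟶ W} {b : W ⟶ X}
    (h : Γ.InSpecialCycle (a.toPath.cons b)) : b.1 = a.1.next := by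
  obtain ⟨o, l, r, h⟩ := h
  have h1 := congrArg pathEntries h
  rw [pathEntries_comp, pathEntries_comp, Entry.cycle, pathEntries_path] at h1
  exact Entry.eq_next_of_seq_eq (l := pathEntries l) (l' := pathEntries r) h1

/-- For `val(α) ≥ 2` the path consists of the first two arrows of the special cycle at `o`. For
`val(α) = 1` the cycle is a loop, too short to contain `aa`, and this is the exception in the
relations of type three; `1 < μ(α)` holds as `α` is nontruncated. -/
theorem inSpecialCycle_of_eq_next {V W X : Γ.QVertex} {a : V ⟶ W} {b : W ⟶ X}
    (h : b.1 = a.1.next) : Γ.InSpecialCycle (a.toPath.cons b) ∨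
      (a.1 = b.1 ∧ Γ.val a.1.vertex = 1 ∧ 1 < Γ.mult a.1.vertex) := by
  obtain ⟨o, rfl, rfl⟩ := a
  obtain ⟨o', h1, rfl⟩ := b
  subst h
  by_cases hv : Γ.val o.vertex = 1
  · refine Or.inr ⟨(o.next_eq_self hv).symm, hv, ?_⟩
    have h2 := o.two_le_len
    rw [Entry.len, hv, one_mul] at h2
    exact h2
  · left
    have := o.val_pos
    obtain ⟨n, hn⟩ := Nat.exists_eq_add_of_le' (by omega : 2 ≤ Γ.val o.vertex)
    obtain ⟨r, hr⟩ := exists_path_eq_comp o n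
    refine ⟨o, Quiver.Path.nil, ?_⟩
    rw [Entry.cycle, hn]
    exact ⟨r, hr⟩

/-! ### The path algebra -/

variable (K : Type w) [Field K]

open PathAlgebra

/-- The path of length `n` that starts at an entry, as an element of the path algebra. -/
def Entry.pathElem (o : Γ.Entry) (n : ℕ) : PathAlgebra K Γ.QVertex := ofPath K (o.path n)

theorem ofPath_cons {a b c : Γ.QVertex} (p : Quiver.Path a b) (f : b ⟶ c) :
    ofPath K (p.cons f) = ofPath K p * ofPath K f.toPath :=
  (ofPath_mul_ofPath_of_eq p f.toPath).symm

theorem ofPath_toPath {a b : Γ.QVertex} (f : a ⟶ b) :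
    ofPath K f.toPath = f.1.pathElem K 1 := by
  obtain ⟨o, rfl, rfl⟩ := f
  rfl

theorem Entry.pathElem_succ (o : Γ.Entry) (n : ℕ) :
    o.pathElem K (n + 1) = o.pathElem K n * (o.iter n).pathElem K 1 := by
  have h := ofPath_cons K (o.path n) (o.iter n).arrow
  rwa [ofPath_toPath] at h

theorem Entry.pathElem_add (o : Γ.Entry) (m n : ℕ) :
    o.pathElem K (m + n) = o.pathElem K m * (o.iter m).pathElem K n := by
  induction n with
  | zero =>
    exact (ofPath_mul_ofPath_of_eq (o.path m) Quiver.Path.nil).symm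
  | succ n ih =>
    rw [← add_assoc, Entry.pathElem_succ, ih, (o.iter m).pathElem_succ K n, mul_assoc,
      Entry.iter_add]

theorem Entry.cyclePow_eq_pathElem (o : Γ.Entry) :
    o.cyclePow K = o.pathElem K o.len := by
  have h : ∀ k, (o.pathElem K (Γ.val o.vertex)) ^ (k + 1) =
      o.pathElem K (Γ.val o.vertex * (k + 1)) := by
    intro k
    induction k with
    | zero => simp
    | succ k ih =>
      rw [pow_succ, ih, mul_add _ (k + 1), mul_one, Entry.pathElem_add, Entry.iter_val_mul]
  obtain ⟨k, hk⟩ := Nat.exists_eq_succ_of_ne_zero (Γ.mult_pos o.vertex).ne'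
  rw [Entry.len, hk]
  rw [Entry.cyclePow, hk]
  exact h k

open Classical in
/-- The linear functional on the path algebra with value `1` at the maximal nonzero paths and
`0` at all other paths. -/
def pathForm (Γ : BrauerConfiguration Γ₀ Γ₁) : PathAlgebra K Γ.QVertex →ₗ[K] K :=
  Finsupp.lift K K (QPath Γ.QVertex) fun p => if IsFull (pathEntries p.2.2) then 1 else 0

open Classical in
theorem pathForm_ofPath {a b : Γ.QVertex} (p : Quiver.Path a b) :
    Γ.pathForm K (ofPath K p) = if IsFull (pathEntries p) then 1 else 0 := by
  have key : ∀ (f : QPath Γ.QVertex → K) (x : QPath Γ.QVertex),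
      Finsupp.lift K K (QPath Γ.QVertex) f (Finsupp.single x 1) = f x := fun f x => by simp
  exact key _ _

open Classical in
theorem pathForm_mul_mul {a b c d e f : Γ.QVertex} (p : Quiver.Path a b) (r : Quiver.Path c d)
    (q : Quiver.Path e f) : Γ.pathForm K (ofPath K p * ofPath K r * ofPath K q) =
      if b = c ∧ d = e ∧ IsFull (pathEntries p ++ pathEntries r ++ pathEntries q) then 1 else 0 := by
  by_cases h1 : b = c
  · subst h1
    rw [ofPath_mul_ofPath_of_eq]
    by_cases h2 : d = e
    · subst h2
      rw [ofPath_mul_ofPath_of_eq, pathForm_ofPath, pathEntries_comp, pathEntries_comp]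
      simp
    · rw [ofPath_mul_ofPath_of_ne _ _ h2, map_zero, if_neg (fun h => h2 h.2.1)]
  · rw [ofPath_mul_ofPath_of_ne _ _ h1, zero_mul, map_zero, if_neg (fun h => h1 h.1)]

theorem pathForm_mul_mul_eq_zero {x : PathAlgebra K Γ.QVertex}
    (h : ∀ {a b c d : Γ.QVertex} (p : Quiver.Path a b) (q : Quiver.Path c d),
      Γ.pathForm K (ofPath K p * x * ofPath K q) = 0) (y z : PathAlgebra K Γ.QVertex) :
    Γ.pathForm K (y * x * z) = 0 := by
  induction y using induction_path with
  | h0 => simp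
  | hadd y y' h h' => rw [add_mul, add_mul, map_add, h, h', add_zero]
  | hsm k p =>
    rw [smul_mul_assoc, smul_mul_assoc, map_smul]
    refine smul_eq_zero_of_right k ?_
    induction z using induction_path with
    | h0 => simp
    | hadd y y' h h' => rw [mul_add, map_add, h, h', add_zero]
    | hsm k q => rw [mul_smul_comm, map_smul, h, smul_zero]

/-- The largest two-sided ideal in the kernel of the functional. -/
def formIdeal (Γ : BrauerConfiguration Γ₀ Γ₁) : TwoSidedIdeal (PathAlgebra K Γ.QVertex) :=
  TwoSidedIdeal.mk' {x | ∀ y z, Γ.pathForm K (y * x * z) = 0}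
    (fun y z => by simp)
    (fun {a b} ha hb y z => by rw [mul_add, add_mul, map_add, ha, hb, add_zero])
    (fun {a} ha y z => by rw [mul_neg, neg_mul, map_neg, ha, neg_zero])
    (fun {a b} hb y z => by rw [← mul_assoc]; exact hb _ _)
    (fun {a b} ha y z => by rw [← mul_assoc, mul_assoc _ b]; exact ha _ _)

/-- Multiply a relation by paths on both sides. For type one, either term becomes maximal only when
the factors are trivial, and then both have value 1. For type two the path is too long, and for type
three it contains two arrows that are not consecutive, so it is not maximal. -/
theorem relIdeal_le_formIdeal : Γ.relIdeal K ≤ Γ.formIdeal K := by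
  classical
  rw [relIdeal, TwoSidedIdeal.span_le]
  have hmem : ∀ x, x ∈ (Γ.formIdeal K : Set _) ↔ ∀ y z, Γ.pathForm K (y * x * z) = 0 := fun x =>
    TwoSidedIdeal.mem_mk' _ _ _ _ _ _ x
  have hcyc : ∀ (o : Γ.Entry) {a b c d : Γ.QVertex} (p : Quiver.Path a b) (q : Quiver.Path c d),
      Γ.pathForm K (ofPath K p * o.pathElem K o.len * ofPath K q) =
        if b = o.vtx ∧ o.vtx = c ∧ pathEntries p = [] ∧ pathEntries q = [] then 1 else 0 := by
    intro o a b c d p q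
    rw [Entry.pathElem, pathForm_mul_mul, pathEntries_path, isFull_append_seq_len_iff]
    simp only [Entry.iter_len]
  rintro x ((⟨o, o', h, rfl⟩ | ⟨o, rfl⟩) | ⟨V, W, X, a, b, h1, h2, rfl⟩)
  · rw [hmem]
    refine pathForm_mul_mul_eq_zero K fun p q => ?_
    have h' : o.vtx = o'.vtx := h
    rw [mul_sub, sub_mul, map_sub, Entry.cyclePow_eq_pathElem, Entry.cyclePow_eq_pathElem, hcyc, hcyc,
      h', sub_self]
  · rw [hmem]
    refine pathForm_mul_mul_eq_zero K fun p q => ?_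
    have : o.cyclePow K * ofPath K o.arrow.toPath = o.pathElem K (o.len + 1) := by
      rw [Entry.pathElem_succ, Entry.cyclePow_eq_pathElem, ofPath_toPath, Entry.iter_len]
      rfl
    rw [this, Entry.pathElem, pathForm_mul_mul, pathEntries_path, if_neg]
    rintro ⟨-, -, h⟩
    have := h.length_eq
    omega
  · rw [hmem]
    refine pathForm_mul_mul_eq_zero K fun p q => ?_
    rw [pathForm_mul_mul, if_neg]
    rintro ⟨-, -, o, h⟩
    exact (inSpecialCycle_of_eq_next (Entry.eq_next_of_seq_eq (l := pathEntries p)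
      (l' := pathEntries q) h.symm)).elim h1 h2

end BrauerConfiguration

theorem perm_apply_inv_apply {α : Type u} (σ : Equiv.Perm α) (a : α) : σ (σ⁻¹ a) = a :=
  σ.apply_symm_apply a

theorem perm_inv_apply_apply {α : Type u} (σ : Equiv.Perm α) (a : α) : σ⁻¹ (σ a) = a :=
  σ.symm_apply_apply a

/-! ### The Brauer configuration algebra as cyclic path data -/

namespace BrauerConfiguration

variable {Γ₀ : Type u} {Γ₁ : Type v} [DecidableEq Γ₀] [Fintype Γ₁]
  (Γ : BrauerConfiguration Γ₀ Γ₁)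

theorem finite_vertex (Γ : BrauerConfiguration Γ₀ Γ₁) : Finite Γ₀ := by
  have h : (⋃ V : Γ₁, {α | α ∈ Γ.polygon V}) = Set.univ :=
    Set.eq_univ_of_forall fun α => Set.mem_iUnion.2 (Γ.exists_polygon α)
  rw [← Set.finite_univ_iff, ← h]
  exact Set.finite_iUnion fun V => (Γ.polygon V).finite_toSet

instance finite_entry : Finite Γ.Entry := by
  have := Γ.finite_vertex
  refine Finite.of_injective (β := Σ α : Γ₀, Σ V : Γ₁, Fin ((Γ.polygon V).count α))
    (fun o => ⟨o.vertex, o.entry⟩) ?_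
  rintro ⟨α, h, o⟩ ⟨β, h', o'⟩ heq
  simp only [Sigma.mk.injEq] at heq
  obtain ⟨rfl, heq⟩ := heq
  rw [eq_of_heq heq]

/-- The entries at which a polygon is listed. -/
def entryEquiv (V : Γ₁) : {o : Γ.Entry // o.poly = V} ≃
    Σ α : {α : Γ₀ // ¬ Γ.IsTruncated α}, Fin ((Γ.polygon V).count α.1) where
  toFun o := ⟨⟨o.1.vertex, o.1.nontruncated⟩,
    Fin.cast (congrArg (fun W => (Γ.polygon W).count o.1.vertex) o.2)
    o.1.entry.2⟩
  invFun p := ⟨⟨p.1.1, p.1.2, ⟨V, p.2⟩⟩, rfl⟩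
  left_inv := by
    rintro ⟨⟨α, h, V, i⟩, rfl⟩
    rfl
  right_inv _ := rfl

theorem card_entry_poly (V : Γ₁) :
    Nat.card {o : Γ.Entry // o.poly = V} = Γ.numNontruncated V := by
  have := Γ.finite_vertex
  have := Fintype.ofFinite Γ₀
  rw [Nat.card_congr (Γ.entryEquiv V), Nat.card_eq_fintype_card, Fintype.card_sigma,
    numNontruncated, Multiset.countP_eq_card_filter,
    ← Multiset.sum_count_eq_card (s := Finset.univ) (by simp)]
  simp only [Fintype.card_fin, Multiset.count_filter]
  rw [← Finset.sum_filter, Finset.sum_subtype (p := fun α => ¬ Γ.IsTruncated α)]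
  simp

theorem exists_entry_poly (V : Γ₁) : ∃ o : Γ.Entry, o.poly = V := by
  obtain ⟨α, h, h'⟩ := Γ.exists_vertex V
  refine ⟨⟨α, h'.ne', ⟨V, ⟨0, ?_⟩⟩⟩, rfl⟩
  exact Multiset.count_pos.2 h

variable (K : Type w) [Field K]

/-- The quotient map onto the Brauer configuration algebra. -/
def quotMap : PathAlgebra K Γ.QVertex →ₗ[K] Γ.BCAlgebra K where
  toFun := (Γ.relIdeal K).ringCon.mk'
  map_add' := map_add _
  map_smul' _ _ := rfl

theorem quotMap_mul (x y : PathAlgebra K Γ.QVertex) :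
    Γ.quotMap K (x * y) = Γ.quotMap K x * Γ.quotMap K y := rfl

theorem quotMap_surjective : Function.Surjective (Γ.quotMap K) := RingCon.mk'_surjective _

theorem quotMap_eq_zero_iff (x : PathAlgebra K Γ.QVertex) :
    Γ.quotMap K x = 0 ↔ x ∈ Γ.relIdeal K :=
  RingCon.eq _

/-- The linear functional on the algebra induced by `pathForm`. -/
def algForm : Γ.BCAlgebra K →ₗ[K] K :=
  (LinearMap.ker (Γ.quotMap K)).liftQ (Γ.pathForm K) (fun x hx => by
    rw [LinearMap.mem_ker, quotMap_eq_zero_iff] at hx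
    have h := (TwoSidedIdeal.mem_mk' _ _ _ _ _ _ x).1 (relIdeal_le_formIdeal K hx) 1 1
    rwa [one_mul, mul_one] at h) ∘ₗ
  ((Γ.quotMap K).quotKerEquivOfSurjective (Γ.quotMap_surjective K)).symm.toLinearMap

theorem algForm_quotMap (x : PathAlgebra K Γ.QVertex) :
    Γ.algForm K (Γ.quotMap K x) = Γ.pathForm K x := by
  have h : ((Γ.quotMap K).quotKerEquivOfSurjective (Γ.quotMap_surjective K)).symm
      (Γ.quotMap K x) = Submodule.Quotient.mk x := by
    rw [LinearEquiv.symm_apply_eq]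
    rfl
  simp only [algForm, LinearMap.comp_apply, LinearEquiv.coe_coe, h]
  rfl

variable {Γ}

/-- The path of length `n` that starts at an entry, as an element of the algebra. -/
def Entry.algElem (o : Γ.Entry) (n : ℕ) : Γ.BCAlgebra K := Γ.quotMap K (o.pathElem K n)

theorem Entry.algElem_zero (o : Γ.Entry) : o.algElem K 0 = Γ.idem K o.poly := rfl

theorem Entry.algElem_add (o : Γ.Entry) (m n : ℕ) :
    o.algElem K (m + n) = o.algElem K m * (o.iter m).algElem K n := by
  rw [algElem, Entry.pathElem_add, quotMap_mul]
  rfl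

/-- Composable arrows give a relation of type three: in the exceptional case `o' = o` with valence
1, whence `o' = o.next`. Arrows that cannot be composed have product zero already in the path
algebra. -/
theorem Entry.algElem_one_mul_of_ne (o o' : Γ.Entry) (h : o' ≠ o.next) :
    o.algElem K 1 * o'.algElem K 1 = 0 := by
  rw [algElem, algElem, ← quotMap_mul, quotMap_eq_zero_iff]
  by_cases hv : o'.poly = o.next.poly
  · let b : o.next.vtx ⟶ o'.next.vtx := ⟨o', hv, rfl⟩
    have hb : PathAlgebra.ofPath K (o.arrow.toPath.cons b) = o.pathElem K 1 * o'.pathElem K 1 := by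
      rw [ofPath_cons, ofPath_toPath, ofPath_toPath]
      rfl
    rw [← hb]
    refine TwoSidedIdeal.subset_span (Or.inr ⟨_, _, _, o.arrow, b, fun h1 => ?_, ?_, rfl⟩)
    · exact h (eq_next_of_inSpecialCycle h1)
    · rintro ⟨h1, h2, -⟩
      have h1 : o = o' := h1
      exact h (by rw [← h1]; exact (o.next_eq_self h2).symm)
  · have h0 : o.pathElem K 1 * o'.pathElem K 1 = 0 :=
      PathAlgebra.ofPath_mul_ofPath_of_ne (o.path 1) (o'.path 1) fun h1 => hv h1.symm
    rw [h0]
    exact zero_mem _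

theorem Entry.algElem_len_eq (o o' : Γ.Entry) (h : o.poly = o'.poly) :
    o.algElem K o.len = o'.algElem K o'.len := by
  rw [← sub_eq_zero, algElem, algElem, ← map_sub, quotMap_eq_zero_iff,
    ← Entry.cyclePow_eq_pathElem, ← Entry.cyclePow_eq_pathElem]
  exact TwoSidedIdeal.subset_span (Or.inl (Or.inl ⟨o, o', h, rfl⟩))

theorem Entry.algElem_len_succ (o : Γ.Entry) : o.algElem K (o.len + 1) = 0 := by
  rw [algElem, quotMap_eq_zero_iff]
  refine TwoSidedIdeal.subset_span (Or.inl (Or.inr ⟨o, ?_⟩))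
  rw [Entry.pathElem_succ, Entry.cyclePow_eq_pathElem, ofPath_toPath, Entry.iter_len]
  rfl

theorem Entry.algForm_algElem (o : Γ.Entry) (n : ℕ) :
    Γ.algForm K (o.algElem K n) = if n = o.len then 1 else 0 := by
  classical
  rw [algElem, algForm_quotMap, Entry.pathElem, pathForm_ofPath, pathEntries_path]
  simp only [isFull_seq_iff]

variable (Γ)

theorem idem_mul_self (V : Γ₁) : Γ.idem K V * Γ.idem K V = Γ.idem K V :=
  congrArg (Γ.quotMap K) (PathAlgebra.ofPath_mul_ofPath_of_eq
    (@Quiver.Path.nil Γ.QVertex _ V) (@Quiver.Path.nil Γ.QVertex _ V))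

theorem idem_mul_of_ne {V W : Γ₁} (h : V ≠ W) : Γ.idem K V * Γ.idem K W = 0 :=
  (congrArg (Γ.quotMap K) (PathAlgebra.ofPath_mul_ofPath_of_ne
    (@Quiver.Path.nil Γ.QVertex _ V) (@Quiver.Path.nil Γ.QVertex _ W) h)).trans (map_zero _)

theorem sum_idem : ∑ V : Γ₁, Γ.idem K V = 1 := by
  have h : Γ.quotMap K 1 = 1 := rfl
  rw [← h, PathAlgebra.one_def, map_sum]
  rfl

/-- By induction on the length of a path: a further arrow either continues the successor sequence or
makes the product zero. -/
theorem span_idem_union_algElem : Submodule.span K (Set.range (Γ.idem K) ∪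
    {y | ∃ (o : Γ.Entry) (n : ℕ), y = o.algElem K n}) = ⊤ := by
  have key : ∀ {a b : Γ.QVertex} (p : Quiver.Path a b),
      Γ.quotMap K (PathAlgebra.ofPath K p) = Γ.idem K b ∨
      Γ.quotMap K (PathAlgebra.ofPath K p) = 0 ∨
      ∃ (o : Γ.Entry) (n : ℕ), Γ.quotMap K (PathAlgebra.ofPath K p) = o.algElem K (n + 1) := by
    intro a b p
    induction p with
    | nil => exact Or.inl rfl
    | cons p f ih =>
      rw [ofPath_cons, quotMap_mul, ofPath_toPath]
      change _ ∨ Γ.quotMap K (PathAlgebra.ofPath K p) * f.1.algElem K 1 = 0 ∨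
        ∃ o n, Γ.quotMap K (PathAlgebra.ofPath K p) * f.1.algElem K 1 = _
      right
      rcases ih with h | h | ⟨o, n, h⟩
      · right
        refine ⟨f.1, 0, ?_⟩
        have h1 := f.1.algElem_add K 0 1
        rw [Entry.algElem_zero, f.2.1] at h1
        rw [h]
        exact h1.symm
      · left
        rw [h, zero_mul]
      · rw [h]
        by_cases hf : f.1 = o.iter (n + 1)
        · exact Or.inr ⟨o, n + 1, by rw [hf, ← Entry.algElem_add]⟩
        · left
          rw [Entry.algElem_add, mul_assoc, Entry.algElem_one_mul_of_ne K _ _ hf, mul_zero]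
  rw [eq_top_iff]
  rintro x -
  obtain ⟨x, rfl⟩ := Γ.quotMap_surjective K x
  induction x using PathAlgebra.induction_path with
  | h0 => rw [map_zero]; exact zero_mem _
  | hadd x y h h' => rw [map_add]; exact add_mem h h'
  | hsm k p =>
    rw [map_smul]
    refine Submodule.smul_mem _ _ ?_
    rcases key p with h | h | ⟨o, n, h⟩
    · rw [h]
      exact Submodule.subset_span (Or.inl ⟨_, rfl⟩)
    · rw [h]
      exact zero_mem _
    · rw [h]
      exact Submodule.subset_span (Or.inr ⟨o, n + 1, rfl⟩)

/-- The paths of the algebra, for left modules: the path `x o n` ends at the entry `o`. -/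
def leftPathData : CyclicPathData K (Γ.BCAlgebra K) Γ₁ Γ.Entry where
  e := Γ.idem K
  -- Left multiplication prolongs a path at its start, so the sequence is followed backwards: this
  -- path begins `n` steps before `o`, and the arrow indexed by `o` is the one that ends there.
  x o n := Entry.algElem K ((Γ.nextPerm⁻¹ ^ n) o) n
  vtx := Entry.poly
  next := Γ.nextPerm⁻¹
  len := Entry.len
  two_le_len := Entry.two_le_len
  len_next o := by
    have h := Entry.len_iter (Γ.nextPerm⁻¹ o) 1
    rwa [← nextPerm_pow_apply, pow_one, perm_apply_inv_apply, eq_comm] at h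
  vtx_surjective := Γ.exists_entry_poly
  e_mul_self := Γ.idem_mul_self K
  e_mul_ne _ _ := Γ.idem_mul_of_ne K
  sum_e := Γ.sum_idem K
  x_zero o := rfl
  x_succ o n := by
    rw [add_comm n 1, Entry.algElem_add, ← nextPerm_pow_apply, pow_add, pow_one, pow_one,
      Equiv.Perm.mul_apply, perm_apply_inv_apply]
  e_mul_x_one o := by
    have h := Entry.algElem_add K (Γ.nextPerm⁻¹ o) 0 1
    rw [zero_add] at h
    rw [pow_one]
    exact h.symm
  x_one_mul_x_one o o' h := by
    rw [pow_one]
    refine Entry.algElem_one_mul_of_ne K _ _ fun h' => h ?_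
    rw [h', ← nextPerm_apply, perm_apply_inv_apply]
  x_len_eq o o' h := by
    have h1 : ∀ o : Γ.Entry, (Γ.nextPerm⁻¹ ^ o.len) o = o := fun o => by
      rw [inv_pow, Equiv.Perm.inv_eq_iff_eq, nextPerm_pow_apply, Entry.iter_len]
    rw [h1, h1]
    exact Entry.algElem_len_eq K o o' h
  x_len_succ o := by
    have h := Entry.algElem_len_succ K ((Γ.nextPerm⁻¹ ^ (o.len + 1)) o)
    have h1 := Entry.len_iter ((Γ.nextPerm⁻¹ ^ (o.len + 1)) o) (o.len + 1)
    rw [← nextPerm_pow_apply, inv_pow, perm_apply_inv_apply] at h1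
    rwa [inv_pow, ← h1, ← inv_pow] at h
  span_eq_top := by
    rw [← Γ.span_idem_union_algElem K]
    congr 2
    ext y
    constructor
    · rintro ⟨o, n, rfl⟩
      exact ⟨_, n, rfl⟩
    · rintro ⟨o, n, rfl⟩
      refine ⟨(Γ.nextPerm ^ n) o, n, ?_⟩
      rw [inv_pow, perm_inv_apply_apply]
  form := Γ.algForm K
  form_x o n := by
    have h1 := Entry.len_iter ((Γ.nextPerm⁻¹ ^ n) o) n
    rw [← nextPerm_pow_apply, inv_pow, perm_apply_inv_apply] at h1
    rw [Entry.algForm_algElem, inv_pow, ← h1]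

/-- The paths of the algebra, for right modules: the path `x o n` starts at the entry `o`. -/
def rightPathData : CyclicPathData K (Γ.BCAlgebra K)ᵐᵒᵖ Γ₁ Γ.Entry where
  e V := MulOpposite.op (Γ.idem K V)
  x o n := MulOpposite.op (Entry.algElem K o n)
  vtx := Entry.poly
  -- Multiplication in the opposite algebra prolongs a path at its end, so successors are followed
  -- forwards.
  next := Γ.nextPerm
  len := Entry.len
  two_le_len := Entry.two_le_len
  len_next o := o.len_iter 1
  vtx_surjective := Γ.exists_entry_poly
  e_mul_self V := by rw [← MulOpposite.op_mul, Γ.idem_mul_self K]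
  e_mul_ne _ _ h := by rw [← MulOpposite.op_mul, Γ.idem_mul_of_ne K h.symm, MulOpposite.op_zero]
  sum_e := by rw [← Finset.op_sum, Γ.sum_idem K, MulOpposite.op_one]
  x_zero o := rfl
  x_succ o n := by
    rw [nextPerm_pow_apply, ← MulOpposite.op_mul, ← Entry.algElem_add]
  e_mul_x_one o := by
    rw [← MulOpposite.op_mul]
    exact congrArg MulOpposite.op (Entry.algElem_add K o 1 0).symm
  x_one_mul_x_one o o' h := by
    rw [← MulOpposite.op_mul, Entry.algElem_one_mul_of_ne K _ _ h, MulOpposite.op_zero]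
  x_len_eq o o' h := congrArg MulOpposite.op (Entry.algElem_len_eq K o o' h)
  x_len_succ o := by rw [Entry.algElem_len_succ, MulOpposite.op_zero]
  span_eq_top := by
    have h := congrArg (Submodule.map
      (MulOpposite.opLinearEquiv K : Γ.BCAlgebra K ≃ₗ[K] _).toLinearMap)
      (Γ.span_idem_union_algElem K)
    rw [Submodule.map_span, Submodule.map_top, LinearEquiv.range] at h
    rw [← h]
    congr 1
    ext y
    constructor
    · rintro (⟨V, rfl⟩ | ⟨o, n, rfl⟩)
      · exact ⟨_, Or.inl ⟨V, rfl⟩, rfl⟩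
      · exact ⟨_, Or.inr ⟨o, n, rfl⟩, rfl⟩
    · rintro ⟨_, ⟨V, rfl⟩ | ⟨o, n, rfl⟩, rfl⟩
      · exact Or.inl ⟨V, rfl⟩
      · exact Or.inr ⟨o, n, rfl⟩
  form := Γ.algForm K ∘ₗ (MulOpposite.opLinearEquiv K).symm.toLinearMap
  form_x o n := Entry.algForm_algElem K o n

theorem isVertexGenerator_proj (V : Γ₁) : (Γ.rightPathData K).IsVertexGenerator V
    (⟨Γ.idem K V, Submodule.mem_span_singleton_self _⟩ : Γ.proj K V) where
  exists_smul_eq := by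
    rintro ⟨y, hy⟩
    obtain ⟨a, rfl⟩ := Submodule.mem_span_singleton.1 hy
    exact ⟨a, rfl⟩
  e_smul := Subtype.ext (Γ.idem_mul_self K V)
  mul_e_eq_zero a ha := MulOpposite.unop_injective (congrArg Subtype.val ha)

end BrauerConfiguration

theorem mainTheorem3 {Γ₀ : Type u} {Γ₁ : Type v} [DecidableEq Γ₀] [Fintype Γ₁]
    (Γ : BrauerConfiguration Γ₀ Γ₁) (K : Type w) [Field K] :
    IsMultiserialAlgebra.{w, max u v w, z} K (Γ.BCAlgebra K) ∧
    ∀ (P : Type z) [AddCommGroup P] [Module (Γ.BCAlgebra K)ᵐᵒᵖ P],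
      Module.Projective (Γ.BCAlgebra K)ᵐᵒᵖ P → IsIndecomposableModule (Γ.BCAlgebra K)ᵐᵒᵖ P →
      (∃! V : Γ₁, Nonempty (P ≃ₗ[(Γ.BCAlgebra K)ᵐᵒᵖ] Γ.proj K V)) ∧
      ∀ V : Γ₁, Nonempty (P ≃ₗ[(Γ.BCAlgebra K)ᵐᵒᵖ] Γ.proj K V) →
        Module.jacobson (Γ.BCAlgebra K)ᵐᵒᵖ (Module.jacobson (Γ.BCAlgebra K)ᵐᵒᵖ P) ≠ ⊥ →
        (∃ N : Fin (Γ.numNontruncated V) →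
              Submodule (Γ.BCAlgebra K)ᵐᵒᵖ (ModuleHeart (Γ.BCAlgebra K)ᵐᵒᵖ P),
            DirectSum.IsInternal N ∧
            ∀ i, Nontrivial (N i) ∧ IsUniserialModule (Γ.BCAlgebra K)ᵐᵒᵖ (N i)) ∧
        ∀ (n : ℕ) (N : Fin n → Submodule (Γ.BCAlgebra K)ᵐᵒᵖ (ModuleHeart (Γ.BCAlgebra K)ᵐᵒᵖ P)),
          DirectSum.IsInternal N →
          (∀ i, IsIndecomposableModule (Γ.BCAlgebra K)ᵐᵒᵖ (N i)) →
          n = Γ.numNontruncated V := by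
  refine ⟨⟨(Γ.leftPathData K).finiteDimensional, fun P _ _ hP hI => ?_, fun P _ _ hP hI => ?_⟩,
    fun P _ _ hP hI => ⟨?_, ?_⟩⟩
  · obtain ⟨V, m, h⟩ := (Γ.leftPathData K).exists_isVertexGenerator hP hI
    exact h.hasMultiserialRadical
  · obtain ⟨V, m, h⟩ := (Γ.rightPathData K).exists_isVertexGenerator hP hI
    exact h.hasMultiserialRadical
  · obtain ⟨V, m, h⟩ := (Γ.rightPathData K).exists_isVertexGenerator hP hI
    refine ⟨V, h.nonempty_linearEquiv (Γ.isVertexGenerator_proj K V), ?_⟩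
    rintro W ⟨f⟩
    exact ((Γ.isVertexGenerator_proj K W).map f.symm).vertex_unique h
  · rintro V ⟨f⟩ -
    exact ((Γ.isVertexGenerator_proj K V).map f.symm).heart_decomposition (Γ.card_entry_poly V)

end
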